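/- Let $d\ge 1$, and let $\phi:\mathbb R\to\mathbb R$ be differentiable (hence continuous), not a polynomial, with $|\phi(t)|\le M$ and $|\phi'(t)|\le L$ for all $t\in\mathbb R$. For a width $p$, let $V\in\mathbb R^{p\times d}$ and $b\in\mathbb R^p$ have independent entries $V_{kj}\sim\mathcal N(0,1/d)$ and $b_k\sim\mathcal N(0,1)$, and let $\varphi(x)=\frac1{\sqrt p}\phi(Vx+b)\in\mathbb R^p$ ($\phi$ applied coordinatewise) and $f(x,\theta)=\varphi(x)^\top\theta$ be the random-feature model. Let $x_1,\dots,x_n\in\mathbb R^d$ with $\|x_i\|_2=\sqrt d$ be training samples such that $\|x_i-x_j\|_2\ge\Delta>0$ for $i\ne j$, with labels $y\in\mathbb R^n$. Let $\Phi=[\varphi(x_1),\dots,\varphi(x_n)]^\top$ and, when $\Phi\Phi^\top$ is invertible, let $\alpha=(\Phi\Phi^\top)^{-1}y$ and let $\theta^*=\Phi^\top\alpha$ be the minimum-norm interpolator. Let $(\hat X,\hat\alpha)$, $\hat X=[\hat x_1,\dots,\hat x_n]^\top$, denote an optimal solution of $$\min_{\substack{\hat X\in\mathbb R^{n\times d},\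 \hat\alpha\in\mathbb R^n\\ \|\hat x_i\|_2=\sqrt d\ \forall i}}\ \Big\|\theta^*-\sum_{i=1}^n\hat\alpha_i\nabla_\theta f(\hat x_i,\theta^*)\Big\|_2^2 .$$ Then there is a constant $C>0$, depending only on $\Delta$, $d$ and $\phi$ (not on $n$, the data, the labels, $c$, $\delta$, $p$), such that for all $c>0$ and $\delta>0$ the following holds with probability at least $1-\delta$ over $(V,b)$. If $\Phi\Phi^\top$ is invertible and $|\alpha_i|\ge c$ for all $i$, then for every optimal solution $(\hat X,\hat\alpha)$ for which $$\delta\le 16C(1+2d)LM\,\frac{(\|\alpha\|_1+\|\hat\alpha\|_1)^2}{\sqrt d\,c^2}$$ and $$p\ge\frac{128C^2M^4(2d+1)(\|\alpha\|_1+\|\hat\alpha\|_1)^4}{c^4}\left(\ln\Big(\frac{2+4d}{\delta}\Big)+\frac{2d}{2d+1}\ln\Big(\frac{24CLM(\|\alpha\|_1+\|\hat\alpha\|_1)^2}{\sqrt d\,c^2}\Big)\right),$$ for every $j\in\{1,\dots,n\}$ there is an $i$ with $\|x_j-\hat x_i\|_2<\Delta$. -/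

import Mathlib

open MeasureTheory ProbabilityTheory
open scoped Matrix

/-- The frozen random first layer: row `k` of the weight matrix `V` (a vector in `ℝ^d`)
together with the `k`-th bias `b k`, for `k = 1, …, p`. -/
abbrev RFWeights (p d : ℕ) : Type := Fin p → (Fin d → ℝ) × ℝ

/-- The law of the first layer: all the entries `V k j ∼ N(0, 1/d)` and `b k ∼ N(0, 1)` are
independent. -/
noncomputable def rfLaw (p d : ℕ) : Measure (RFWeights p d) :=
  Measure.pi fun _ : Fin p =>
    (Measure.pi fun _ : Fin d => gaussianReal 0 (d : NNReal)⁻¹).prod (gaussianReal 0 1)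

/-- The random features `x ↦ p^{-1/2} φ(V x + b)`, with `φ` applied coordinatewise. -/
noncomputable def rfFeature {p d : ℕ} (φ : ℝ → ℝ) (W : RFWeights p d)
    (x : EuclideanSpace ℝ (Fin d)) : EuclideanSpace ℝ (Fin p) :=
  WithLp.toLp 2 fun k => 1 / √(p : ℝ) * φ (∑ j, (W k).1 j * x j + (W k).2)

/-- The random feature model `f(x, θ) = p^{-1/2} φ(V x + b)ᵀ θ`. -/
noncomputable def rfModel {p d : ℕ} (φ : ℝ → ℝ) (W : RFWeights p d)
    (x : EuclideanSpace ℝ (Fin d)) (θ : EuclideanSpace ℝ (Fin p)) : ℝ :=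
  inner ℝ (rfFeature φ W x) θ

/-- The `n × p` matrix `Φ` whose rows are the features of the training samples. -/
noncomputable def featureMatrix {n p d : ℕ} (φ : ℝ → ℝ) (W : RFWeights p d)
    (x : Fin n → EuclideanSpace ℝ (Fin d)) : Matrix (Fin n) (Fin p) ℝ :=
  Matrix.of fun i k => rfFeature φ W (x i) k

/-- The Gram matrix `Φ Φᵀ`. -/
noncomputable def gramMatrix {n p d : ℕ} (φ : ℝ → ℝ) (W : RFWeights p d)
    (x : Fin n → EuclideanSpace ℝ (Fin d)) : Matrix (Fin n) (Fin n) ℝ :=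
  featureMatrix φ W x * (featureMatrix φ W x)ᵀ

/-- The coefficients `α = (Φ Φᵀ)⁻¹ y` (used when `Φ Φᵀ` is invertible). -/
noncomputable def interpCoeff {n p d : ℕ} (φ : ℝ → ℝ) (W : RFWeights p d)
    (x : Fin n → EuclideanSpace ℝ (Fin d)) (y : Fin n → ℝ) : Fin n → ℝ :=
  (gramMatrix φ W x)⁻¹ *ᵥ y

/-- The trained parameters `θ* = Φᵀ (Φ Φᵀ)⁻¹ y = Φᵀ α`: the minimum-norm interpolator. -/
noncomputable def trainedParam {n p d : ℕ} (φ : ℝ → ℝ) (W : RFWeights p d)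
    (x : Fin n → EuclideanSpace ℝ (Fin d)) (y : Fin n → ℝ) : EuclideanSpace ℝ (Fin p) :=
  WithLp.toLp 2 ((featureMatrix φ W x)ᵀ *ᵥ interpCoeff φ W x y)

/-- The reconstruction loss
`‖(θf - θ0) - ∑ i, a i • ∇_θ f(z i, θf)‖²` of a parameterized model `f`. -/
noncomputable def reconLoss {n m d : ℕ}
    (f : EuclideanSpace ℝ (Fin d) → EuclideanSpace ℝ (Fin m) → ℝ)
    (θ0 θf : EuclideanSpace ℝ (Fin m))
    (z : Fin n → EuclideanSpace ℝ (Fin d)) (a : Fin n → ℝ) : ℝ :=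
  ‖(θf - θ0) - ∑ i, a i • gradient (f (z i)) θf‖ ^ 2

/-- `(z, a)` is an optimal solution of the problem of minimizing the reconstruction loss over
all `n`-tuples of points of the sphere of radius `√d` in `ℝ^d` and all coefficients in `ℝ^n`. -/
def IsReconOptimal {n m d : ℕ}
    (f : EuclideanSpace ℝ (Fin d) → EuclideanSpace ℝ (Fin m) → ℝ)
    (θ0 θf : EuclideanSpace ℝ (Fin m))
    (z : Fin n → EuclideanSpace ℝ (Fin d)) (a : Fin n → ℝ) : Prop :=
  (∀ i, ‖z i‖ = √(d : ℝ)) ∧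
    ∀ (z' : Fin n → EuclideanSpace ℝ (Fin d)) (a' : Fin n → ℝ), (∀ i, ‖z' i‖ = √(d : ℝ)) →
      reconLoss f θ0 θf z a ≤ reconLoss f θ0 θf z' a'

/-- The `ℓ¹` norm of a vector of coefficients. -/
def l1norm {n : ℕ} (a : Fin n → ℝ) : ℝ := ∑ i, |a i|

/-!
An optimal solution `(X̂, α̂)` has zero loss, because the training set itself has. Hence the signed
measure `ν = ∑ i, α i • δ (x i) - ∑ i, α̂ i • δ (x̂ i)` is annihilated by all `p` random neurons, and
`∫∫ k dν dν = 0` for the empirical kernel `k x x' = φ(x) ⬝ φ(x')`. If `k` is uniformly within `ε` of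
its mean `K`, then `∫∫ K dν dν ≤ ε (‖α‖₁ + ‖α̂‖₁)²`. So the theorem rests on two facts.

*Lower bound* (`exists_sq_coeff_le_integral`). If no `x̂ i` is within `Δ` of `x j`, then
`(α j)² ≤ C₀ ∫∫ K dν dν`, with `C₀` depending only on `φ`, `d`, `Δ` and the number of atoms; the
number of training points is itself bounded by a packing argument (`exists_card_le_of_separated`).
The bound has to be uniform over all positions of the atoms, which may coalesce, so a test function
in the range of `g ↦ 𝔼[g φ(v ⬝ x + b)]` is needed that vanishes *exactly* at every atom except `x j`.
Replace the law of `(v, b)` by a Gaussian with mean `(u, τ)` and variances scaled by `r < 1`: it has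
bounded density with respect to the original law (`exists_rowLaw_le_smul`), and on the sphere of
radius `√d` the mean of `φ(v ⬝ x + b)` becomes `Ψ(u ⬝ x + τ)`, with `Ψ` the convolution of `φ` with
`N(0, 2 r)`. A mixed finite difference of `Ψ` whose steps are the values at `x` of affine forms `ℓ i`
vanishes as soon as one step is zero. Let `ℓ i` vanish at the `i`-th atom and take one common value
`h` at `x j`; at `x j` the result is an `m`-th difference of `Ψ` with step `h`. It is nonzero for
suitable `h` and base point, since a bounded function all of whose `m`-th differences vanish is
constant, and `Ψ` is not constant for small `r`.

*Concentration* (`exists_event_kernel_close`). Hoeffding's inequality on a grid, together with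
Markov's inequality for the Lipschitz constant of the empirical kernel, bounds `|k - K|` uniformly on
the sphere.

The event must not depend on `‖α‖₁ + ‖α̂‖₁`, which is random. The width condition confines this number
to a bounded set, and `ε` is chosen for an element of that set larger than half its supremum; the
factor lost is absorbed in `C`. Taking `C` large compared with `√d / (|φ'(u₀)| |φ(t₀)|)` keeps
the argument of the second logarithm at least `1`.
-/

/-! ### Finite differences of bounded functions -/

section FiniteDifferences

/-- A bounded function whose `m`-th differences with step `h` all vanish is `h`-periodic: along
`t + ℕ h` it is a bounded polynomial. -/
theorem apply_add_eq_of_fwdDiff_iter_eq_zero {f : ℝ → ℝ} {M : ℝ} (hM : ∀ t, |f t| ≤ M) (h : ℝ)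
    (m : ℕ)
    (hm : ∀ t, (fwdDiff h)^[m] f t = 0) : ∀ t, f (t + h) = f t := by
  induction m generalizing f M with
  | zero => simp_all
  | succ m ih =>
    intro t
    -- `g = Δ_h f` is bounded with `m`-th difference zero, hence `h`-periodic
    have hg : ∀ t, fwdDiff h f (t + h) = fwdDiff h f t := by
      intro t
      refine ih (f := fwdDiff h f) (M := M + M) (fun s => ?_) (fun s => hm s) t
      exact (abs_sub _ _).trans (add_le_add (hM _) (hM _))
    have hlin : ∀ k : ℕ, fwdDiff h f (t + k * h) = fwdDiff h f t ∧
        f (t + k * h) = f t + k * fwdDiff h f t := by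
      intro k
      induction k with
      | zero => simp
      | succ k ihk =>
        have e : t + ((k + 1 : ℕ) : ℝ) * h = t + k * h + h := by push_cast; ring
        refine ⟨by rw [e, hg, ihk.1], ?_⟩
        have : f (t + k * h + h) = f (t + k * h) + fwdDiff h f (t + k * h) := by
          simp [fwdDiff]
        rw [e, this, ihk.1, ihk.2]; push_cast; ring
    by_contra hne
    have hpos : 0 < |fwdDiff h f t| := abs_pos.2 (sub_ne_zero.2 hne)
    obtain ⟨k, hk⟩ := exists_nat_gt ((M + M) / |fwdDiff h f t|)
    rw [div_lt_iff₀ hpos] at hk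
    have h1 : (k : ℝ) * fwdDiff h f t = f (t + k * h) - f t := by rw [(hlin k).2]; ring
    have h2 : (k : ℝ) * |fwdDiff h f t| ≤ M + M := by
      rw [← Nat.abs_cast k, ← abs_mul, h1]
      exact (abs_sub _ _).trans (add_le_add (hM _) (hM _))
    linarith

theorem exists_fwdDiff_iter_ne_zero {f : ℝ → ℝ} {M : ℝ} (hM : ∀ t, |f t| ≤ M) {a b : ℝ}
    (hab : f a ≠ f b) (m : ℕ) : ∃ h t, (fwdDiff h)^[m] f t ≠ 0 := by
  by_contra! H
  apply hab
  simpa using (apply_add_eq_of_fwdDiff_iter_eq_zero hM (b - a) m (H (b - a)) a).symm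

/-- The mixed difference of `f` at `t` with steps `ℓ i`, up to the global sign `(-1) ^ card ι`, as
an alternating sum over the vertices `t + ∑ i ∈ A, ℓ i` of a parallelepiped. -/
noncomputable def mixedDiff {ι : Type*} [Fintype ι] (f : ℝ → ℝ) (t : ℝ) (ℓ : ι → ℝ) : ℝ :=
  ∑ A : Finset ι, (-1) ^ A.card * f (t + ∑ i ∈ A, ℓ i)

/-- The vertices with and without a zero step `k` cancel in pairs. -/
theorem mixedDiff_eq_zero {ι : Type*} [Fintype ι] (f : ℝ → ℝ) (t : ℝ) (ℓ : ι → ℝ) {k : ι}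
    (hk : ℓ k = 0) : mixedDiff f t ℓ = 0 := by
  classical
  refine Finset.sum_involution (fun A _ => if k ∈ A then A.erase k else insert k A) ?_ ?_ ?_ ?_
  · intro A _
    by_cases h : k ∈ A
    · have h1 : A.card = (A.erase k).card + 1 := (Finset.card_erase_add_one h).symm
      have h2 : ∑ i ∈ A.erase k, ℓ i = ∑ i ∈ A, ℓ i := Finset.sum_erase _ hk
      simp only [if_pos h, h2]
      rw [h1, pow_succ]; ring
    · simp only [if_neg h, Finset.card_insert_of_notMem h, Finset.sum_insert h, hk, zero_add,
        pow_succ]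
      ring
  · intro A _ _ hA
    by_cases h : k ∈ A
    · rw [if_pos h] at hA
      exact Finset.erase_eq_self.1 hA h
    · rw [if_neg h] at hA
      exact h (hA ▸ Finset.mem_insert_self k A)
  · intro A _; exact Finset.mem_univ _
  · intro A _
    by_cases h : k ∈ A
    · simp [h, Finset.insert_erase h]
    · simp [h, Finset.erase_insert h]

theorem mixedDiff_const_step {ι : Type*} [Fintype ι] (f : ℝ → ℝ) (t h : ℝ) :
    mixedDiff f t (fun _ : ι => h) =
      (-1) ^ Fintype.card ι * (fwdDiff h)^[Fintype.card ι] f t := by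
  classical
  have := Finset.sum_powerset_apply_card (fun j => (-1 : ℝ) ^ j * f (t + j * h))
    (x := (Finset.univ : Finset ι))
  rw [mixedDiff, fwdDiff_iter_eq_sum_shift, Finset.mul_sum]
  simp only [Finset.sum_const, nsmul_eq_mul]
  rw [← Finset.powerset_univ, this, Finset.card_univ]
  refine Finset.sum_congr rfl fun j hj => ?_
  have hj' : j ≤ Fintype.card ι := Nat.lt_succ_iff.1 (Finset.mem_range.1 hj)
  have e : (-1 : ℝ) ^ Fintype.card ι * (-1) ^ (Fintype.card ι - j) = (-1) ^ j := by
    obtain ⟨l, hl⟩ := Nat.exists_eq_add_of_le hj'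
    rw [hl, Nat.add_sub_cancel_left, pow_add, mul_assoc, ← pow_add, ← two_mul]
    simp [pow_mul]
  simp only [nsmul_eq_mul, zsmul_eq_mul]
  push_cast
  rw [← e]
  ring

end FiniteDifferences

/-! ### Shifted Gaussian laws of a neuron and Gaussian smoothing -/

section Gaussian

open scoped NNReal ENNReal

/-- The law of a neuron `(v, b)` with independent entries `v j ∼ N(u j, r / d)` and `b ∼ N(τ, r)`;
`rowLaw 0 0 1` is the law of one neuron in `rfLaw`. -/
noncomputable def rowLaw {d : ℕ} (u : Fin d → ℝ) (τ : ℝ) (r : ℝ≥0) :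
    Measure ((Fin d → ℝ) × ℝ) :=
  (Measure.pi fun j : Fin d => gaussianReal (u j) (r * (d : ℝ≥0)⁻¹)).prod (gaussianReal τ r)

instance {d : ℕ} (u : Fin d → ℝ) (τ : ℝ) (r : ℝ≥0) : IsProbabilityMeasure (rowLaw u τ r) := by
  unfold rowLaw; infer_instance

/-- The pre-activation `v ⬝ x + b` of the neuron `w = (v, b)` at `x`. -/
noncomputable def preact {d : ℕ} (x : EuclideanSpace ℝ (Fin d)) (w : (Fin d → ℝ) × ℝ) : ℝ :=
  ∑ j, w.1 j * x j + w.2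

@[fun_prop]
theorem continuous_preact {d : ℕ} (x : EuclideanSpace ℝ (Fin d)) : Continuous (preact x) := by
  unfold preact; fun_prop

/-- On the sphere of radius `√d` the variance of the pre-activation does not depend on `x`. -/
theorem map_preact_rowLaw {d : ℕ} (hd : 0 < d) (u : Fin d → ℝ) (τ : ℝ) (r : ℝ≥0)
    {x : EuclideanSpace ℝ (Fin d)} (hx : ‖x‖ = √(d : ℝ)) :
    (rowLaw u τ r).map (preact x) = gaussianReal (∑ j, u j * x j + τ) (2 * r) := by
  have hx2 : ∑ j, x j ^ 2 = d := by
    have := EuclideanSpace.norm_sq_eq x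
    rw [hx, Real.sq_sqrt (by positivity)] at this
    simpa using this.symm
  have : IsProbabilityMeasure ((rowLaw u τ r).map (preact x)) :=
    Measure.isProbabilityMeasure_map (continuous_preact x).measurable.aemeasurable
  refine Measure.ext_of_charFun (funext fun t => ?_)
  rw [charFun_gaussianReal, charFun_apply_real, integral_map
    (continuous_preact x).measurable.aemeasurable (by fun_prop)]
  have h1 : ∀ w : (Fin d → ℝ) × ℝ, Complex.exp (t * (preact x w : ℝ) * Complex.I) =
      (∏ j, Complex.exp (((t * x j : ℝ) : ℂ) * (w.1 j : ℝ) * Complex.I)) *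
        Complex.exp ((t : ℝ) * (w.2 : ℝ) * Complex.I) := by
    intro w
    rw [← Complex.exp_sum, ← Complex.exp_add]
    congr 1
    simp only [preact]
    push_cast
    rw [mul_add, add_mul, Finset.mul_sum, Finset.sum_mul]
    congr 1
    exact Finset.sum_congr rfl fun j _ => by ring
  simp_rw [h1]
  rw [rowLaw, integral_prod_mul (fun v : Fin d → ℝ =>
      ∏ j, Complex.exp (((t * x j : ℝ) : ℂ) * (v j : ℝ) * Complex.I))
      (fun b : ℝ => Complex.exp ((t : ℝ) * (b : ℝ) * Complex.I)),
    integral_fintype_prod_eq_prod (fun j (y : ℝ) =>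
      Complex.exp (((t * x j : ℝ) : ℂ) * (y : ℝ) * Complex.I))]
  simp_rw [← charFun_apply_real, charFun_gaussianReal]
  rw [← Complex.exp_sum, ← Complex.exp_add]
  congr 1
  have hx2' : ∑ j, ((x j : ℝ) : ℂ) ^ 2 = d := by exact_mod_cast hx2
  have hd' : (d : ℂ) ≠ 0 := by exact_mod_cast hd.ne'
  rw [Finset.sum_sub_distrib]
  have e2 : ∑ j, (((r * (d : ℝ≥0)⁻¹ : ℝ≥0) : ℝ) : ℂ) * (((t * x j : ℝ) : ℂ)) ^ 2 / 2 =
      (r : ℂ) * t ^ 2 / 2 := by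
    have : ∀ j, (((r * (d : ℝ≥0)⁻¹ : ℝ≥0) : ℝ) : ℂ) * (((t * x j : ℝ) : ℂ)) ^ 2 / 2 =
        (r * t ^ 2 / (2 * d)) * ((x j : ℝ) : ℂ) ^ 2 := by
      intro j; push_cast; field_simp
    simp_rw [this]
    rw [← Finset.mul_sum, hx2']
    field_simp
  rw [e2]
  have e1 : ∑ j, ((t * x j : ℝ) : ℂ) * ((u j : ℝ) : ℂ) * Complex.I =
      t * (∑ j, ((u j : ℝ) : ℂ) * ((x j : ℝ) : ℂ)) * Complex.I := by
    rw [Finset.mul_sum, Finset.sum_mul]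
    exact Finset.sum_congr rfl fun j _ => by push_cast; ring
  rw [e1]
  push_cast
  ring

theorem MeasureTheory.Measure.pi_mono_of_le {ι : Type*} [Fintype ι] {α : ι → Type*}
    [∀ i, MeasurableSpace (α i)] {μ ν : ∀ i, Measure (α i)} [∀ i, SigmaFinite (μ i)]
    (h : ∀ i, μ i ≤ ν i) : Measure.pi μ ≤ Measure.pi ν := by
  refine Measure.le_iff.2 fun s hs => ?_
  rw [Measure.pi, Measure.pi, toMeasure_apply _ _ hs, toMeasure_apply _ _ hs]
  have : OuterMeasure.pi (fun i => (μ i).toOuterMeasure) ≤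
      OuterMeasure.pi (fun i => (ν i).toOuterMeasure) := by
    rw [OuterMeasure.le_pi]
    intro s _
    exact (OuterMeasure.pi_pi_le _ _).trans (Finset.prod_le_prod' fun i _ => h i (s i))
  exact this s

theorem MeasureTheory.Measure.pi_smul_const {ι : Type*} [Fintype ι] {α : ι → Type*}
    [∀ i, MeasurableSpace (α i)] (μ : ∀ i, Measure (α i)) [∀ i, SigmaFinite (μ i)]
    (B : ℝ≥0) : Measure.pi (fun i => B • μ i) = B ^ Fintype.card ι • Measure.pi μ := by
  refine Measure.pi_eq fun s _ => ?_
  simp only [Measure.smul_apply, ENNReal.smul_def, smul_eq_mul, Finset.prod_mul_distrib,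
    Finset.prod_const, Finset.card_univ, Measure.pi_pi, ENNReal.coe_pow]

/-- A Gaussian of smaller variance has bounded density with respect to a centred one, locally
uniformly in its mean. -/
theorem exists_gaussianReal_le_smul {v' v : ℝ≥0} (hv' : 0 < v') (hv : v' < v) (A : ℝ) :
    ∃ B : ℝ≥0, ∀ a : ℝ, |a| ≤ A → gaussianReal a v' ≤ B • gaussianReal 0 v := by
  have hv0 : 0 < v := hv'.trans hv
  have hv'R : (0 : ℝ) < v' := hv'
  have hvR : (0 : ℝ) < v := hv0
  have hlt : (0 : ℝ) < v - v' := sub_pos.2 (NNReal.coe_lt_coe.2 hv)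
  set D : ℝ := √(2 * Real.pi * v) / √(2 * Real.pi * v') * Real.exp (A ^ 2 / (2 * (v - v')))
  have hD : 0 ≤ D := by positivity
  refine ⟨NNReal.mk D hD, fun a ha => ?_⟩
  rw [gaussianReal_of_var_ne_zero _ hv'.ne', gaussianReal_of_var_ne_zero _ hv0.ne']
  have hpt : ∀ t, gaussianPDFReal a v' t ≤ D * gaussianPDFReal 0 v t := by
    intro t
    have hs1 : 0 < √(2 * Real.pi * v) := by positivity
    have hs2 : 0 < √(2 * Real.pi * v') := by positivity
    have hexp : -(t - a) ^ 2 / (2 * v') ≤ A ^ 2 / (2 * (v - v')) + -(t - 0) ^ 2 / (2 * v) := by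
      have ha2 : a ^ 2 ≤ A ^ 2 := sq_le_sq' (by linarith [neg_abs_le a]) (by linarith [le_abs_self a])
      -- complete the square in `t`
      have key : A ^ 2 / (2 * (v - v')) + -(t - 0) ^ 2 / (2 * v) - -(t - a) ^ 2 / (2 * v') =
          ((A ^ 2 - a ^ 2) * v * v' + ((v - v') * t - v * a) ^ 2) / (2 * v * v' * (v - v')) := by
        field_simp
        ring
      have : 0 ≤ ((A ^ 2 - a ^ 2) * v * v' + ((v - v') * t - v * a) ^ 2) /
          (2 * v * v' * (v - v')) := by
        have := sub_nonneg.2 ha2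
        positivity
      linarith
    rw [gaussianPDFReal_def, gaussianPDFReal_def]
    calc (√(2 * Real.pi * v'))⁻¹ * Real.exp (-(t - a) ^ 2 / (2 * v'))
        ≤ (√(2 * Real.pi * v'))⁻¹ *
          Real.exp (A ^ 2 / (2 * (v - v')) + -(t - 0) ^ 2 / (2 * v)) := by gcongr
      _ = D * ((√(2 * Real.pi * v))⁻¹ * Real.exp (-(t - 0) ^ 2 / (2 * v))) := by
        rw [Real.exp_add]; simp only [D]; field_simp
  have hle : gaussianPDF a v' ≤ (NNReal.mk D hD) • gaussianPDF 0 v := by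
    intro t
    simp only [gaussianPDF_def, Pi.smul_apply, ENNReal.smul_def, smul_eq_mul]
    refine (ENNReal.ofReal_le_ofReal (hpt t)).trans (le_of_eq ?_)
    rw [ENNReal.ofReal_mul hD]
    congr 1
    exact ENNReal.ofReal_eq_coe_nnreal hD
  refine (withDensity_mono (Filter.Eventually.of_forall hle)).trans (le_of_eq ?_)
  have := withDensity_smul (μ := (volume : Measure ℝ)) (NNReal.mk D hD : ℝ≥0∞)
    (measurable_gaussianPDF 0 v)
  exact this

theorem exists_rowLaw_le_smul {d : ℕ} (hd : 0 < d) {r : ℝ≥0} (hr0 : 0 < r) (hr : r < 1) (A : ℝ) :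
    ∃ B : ℝ≥0, ∀ (u : Fin d → ℝ) (τ : ℝ), (∀ j, |u j| ≤ A) → |τ| ≤ A →
      rowLaw u τ r ≤ B • rowLaw (0 : Fin d → ℝ) 0 1 := by
  have hd' : (0 : ℝ≥0) < (d : ℝ≥0)⁻¹ := by positivity
  obtain ⟨B₁, hB₁⟩ := exists_gaussianReal_le_smul (v' := r * (d : ℝ≥0)⁻¹) (v := 1 * (d : ℝ≥0)⁻¹)
    (by positivity) (by gcongr) A
  obtain ⟨B₂, hB₂⟩ := exists_gaussianReal_le_smul hr0 hr A
  refine ⟨B₁ ^ d * B₂, fun u τ hu hτ => ?_⟩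
  have h1 : (Measure.pi fun j : Fin d => gaussianReal (u j) (r * (d : ℝ≥0)⁻¹)) ≤
      B₁ ^ d • Measure.pi fun j : Fin d => gaussianReal 0 (1 * (d : ℝ≥0)⁻¹) := by
    have := Measure.pi_smul_const (fun _ : Fin d => gaussianReal 0 (1 * (d : ℝ≥0)⁻¹)) B₁
    rw [Fintype.card_fin] at this
    rw [← this]
    exact Measure.pi_mono_of_le fun j => hB₁ _ (hu j)
  refine (Measure.prod_mono h1 (hB₂ τ hτ)).trans (le_of_eq ?_)
  simp only [rowLaw, Pi.zero_apply]
  simp_rw [Measure.prod_smul_left, Measure.prod_smul_right, smul_smul]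

/-- The convolution of `φ` with `N(0, 2 r)`. -/
noncomputable def gaussSmooth (φ : ℝ → ℝ) (r : ℝ≥0) (t : ℝ) : ℝ :=
  ∫ y, φ y ∂gaussianReal t (2 * r)

theorem abs_gaussSmooth_le {φ : ℝ → ℝ} {M : ℝ} (hM : ∀ t, |φ t| ≤ M) (r : ℝ≥0) (t : ℝ) :
    |gaussSmooth φ r t| ≤ M := by
  have := norm_integral_le_of_norm_le_const (μ := gaussianReal t (2 * r)) (f := φ)
    (Filter.Eventually.of_forall hM)
  simpa [gaussSmooth] using this

/-- As `r → 0` the smoothed function tends to `φ` pointwise. -/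
theorem exists_gaussSmooth_ne {φ : ℝ → ℝ} (hφ : Continuous φ) {M : ℝ} (hM : ∀ t, |φ t| ≤ M)
    {a b : ℝ} (hab : φ a ≠ φ b) :
    ∃ r : ℝ≥0, 0 < r ∧ r < 1 ∧ gaussSmooth φ r a ≠ gaussSmooth φ r b := by
  have hrep : ∀ (s : ℝ) (hs : 0 ≤ s) (t : ℝ), gaussSmooth φ (Real.toNNReal (s ^ 2 / 2)) t =
      ∫ y, φ (s * y + t) ∂gaussianReal 0 1 := by
    intro s hs t
    have h := gaussianReal_map_const_mul (μ := 0) (v := 1) s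
    have h2 := gaussianReal_map_add_const (μ := s * 0) (v := .mk (s ^ 2) (sq_nonneg _) * 1) t
    rw [← h, Measure.map_map (by fun_prop) (by fun_prop)] at h2
    have e : gaussianReal t (2 * Real.toNNReal (s ^ 2 / 2)) =
        gaussianReal (s * 0 + t) (.mk (s ^ 2) (sq_nonneg _) * 1) := by
      congr 1
      · ring
      · ext; push_cast; rw [Real.coe_toNNReal _ (by positivity)]; simp; ring
    rw [gaussSmooth, e, ← h2, integral_map (by fun_prop) (hφ.aestronglyMeasurable)]
    rfl
  have hlim : ∀ t, Filter.Tendsto (fun s : ℝ => ∫ y, φ (s * y + t) ∂gaussianReal 0 1)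
      (nhdsWithin 0 (Set.Ioi 0)) (nhds (φ t)) := by
    intro t
    have h0 : φ t = ∫ y, φ (0 * y + t) ∂gaussianReal 0 1 := by simp
    rw [h0]
    have hc : Continuous fun s : ℝ => ∫ y, φ (s * y + t) ∂gaussianReal 0 1 := by
      refine continuous_of_dominated (bound := fun _ => M) (fun s => ?_) (fun s => ?_) ?_ ?_
      · exact (hφ.comp (by fun_prop)).aestronglyMeasurable
      · exact Filter.Eventually.of_forall fun y => hM _
      · exact integrable_const _
      · exact Filter.Eventually.of_forall fun y => hφ.comp (by fun_prop)
    exact hc.continuousAt.tendsto.mono_left nhdsWithin_le_nhds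
  have hev := (((hlim a).sub (hlim b)).eventually_ne (sub_ne_zero.2 hab)).and
    (Ioo_mem_nhdsGT (show (0 : ℝ) < 1 by norm_num))
  obtain ⟨s, hs, hs0, hs1⟩ := hev.exists
  refine ⟨Real.toNNReal (s ^ 2 / 2), ?_, ?_, ?_⟩
  · exact Real.toNNReal_pos.2 (by positivity)
  · rw [Real.toNNReal_lt_one]; nlinarith
  · rw [hrep s hs0.le, hrep s hs0.le]; exact sub_ne_zero.1 hs

theorem integral_preact_rowLaw {d : ℕ} (hd : 0 < d) {φ : ℝ → ℝ} (hφ : Continuous φ)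
    (u : Fin d → ℝ) (τ : ℝ) (r : ℝ≥0) {x : EuclideanSpace ℝ (Fin d)} (hx : ‖x‖ = √(d : ℝ)) :
    ∫ w, φ (preact x w) ∂rowLaw u τ r = gaussSmooth φ r (∑ j, u j * x j + τ) := by
  rw [gaussSmooth, ← map_preact_rowLaw hd u τ r hx,
    integral_map (by fun_prop) hφ.aestronglyMeasurable]

end Gaussian

/-! ### Lower bound for the kernel energy, and packing -/

section LowerBound

open scoped NNReal ENNReal

/-- Nonnegativity of the variance of `|F|`. -/
theorem sq_integral_abs_le {Ω : Type*} [MeasurableSpace Ω] {μ : Measure Ω} [IsProbabilityMeasure μ]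
    {F : Ω → ℝ} (hF : Integrable F μ) (hF2 : Integrable (fun w => F w ^ 2) μ) :
    (∫ w, |F w| ∂μ) ^ 2 ≤ ∫ w, F w ^ 2 ∂μ := by
  set m := ∫ w, |F w| ∂μ with hm
  have h0 : 0 ≤ ∫ w, (|F w| - m) ^ 2 ∂μ := integral_nonneg fun w => sq_nonneg _
  have h1 : ∀ w, (|F w| - m) ^ 2 = F w ^ 2 - (2 * m) * |F w| + m ^ 2 := by
    intro w; rw [sub_sq, sq_abs]; ring
  simp_rw [h1] at h0
  have h2 : Integrable (fun w => 2 * m * |F w|) μ := hF.abs.const_mul _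
  have h3 : Integrable (fun w => F w ^ 2 - 2 * m * |F w|) μ := hF2.sub h2
  rw [integral_add h3 (integrable_const _), integral_sub hF2 h2, integral_const_mul, ← hm] at h0
  simp only [integral_const, probReal_univ, smul_eq_mul, one_mul] at h0
  nlinarith

/-- The affine form is `h (d - ⟪y, q⟫) / (d - ⟪x, q⟫)`, whose denominator is `‖x - q‖² / 2`. -/
theorem exists_affineForm_vanishing {d : ℕ} (hd : 0 < d) {Δ : ℝ} (hΔ : 0 < Δ) (h : ℝ)
    {x q : EuclideanSpace ℝ (Fin d)} (hx : ‖x‖ = √(d : ℝ)) (hq : ‖q‖ = √(d : ℝ))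
    (hxq : Δ ≤ ‖x - q‖) :
    ∃ (u : Fin d → ℝ) (τ : ℝ), (∀ j, |u j| ≤ 2 * d * |h| / Δ ^ 2) ∧ |τ| ≤ 2 * d * |h| / Δ ^ 2 ∧
      ∑ j, u j * x j + τ = h ∧ ∑ j, u j * q j + τ = 0 := by
  have hd1 : (1 : ℝ) ≤ d := by exact_mod_cast hd
  have hsq : √(d : ℝ) ^ 2 = d := Real.sq_sqrt (by positivity)
  have hsqrt : √(d : ℝ) ≤ d := by
    rw [Real.sqrt_le_left (by positivity)]; nlinarith
  have inner_eq : ∀ y : EuclideanSpace ℝ (Fin d), ∑ j, q j * y j = inner ℝ y q := by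
    intro y; simp [PiLp.inner_apply]
  set D : ℝ := d - inner ℝ x q with hD
  have hDeq : ‖x - q‖ ^ 2 = 2 * D := by
    rw [norm_sub_sq_real, hx, hq, hsq, hD]; ring
  have hDge : Δ ^ 2 / 2 ≤ D := by
    have : Δ ^ 2 ≤ ‖x - q‖ ^ 2 := by gcongr
    linarith
  have hDpos : 0 < D := lt_of_lt_of_le (by positivity) hDge
  have hbound : |h / D| ≤ 2 * |h| / Δ ^ 2 := by
    rw [abs_div, abs_of_pos hDpos, div_le_div_iff₀ hDpos (by positivity)]
    nlinarith [abs_nonneg h]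
  refine ⟨fun j => -(h / D) * q j, h / D * d, fun j => ?_, ?_, ?_, ?_⟩
  · rw [abs_mul, abs_neg]
    have hqj : |q j| ≤ d := by
      have := PiLp.norm_apply_le q j
      rw [hq] at this
      exact this.trans hsqrt
    calc |h / D| * |q j| ≤ 2 * |h| / Δ ^ 2 * d := by gcongr
      _ = _ := by ring
  · rw [abs_mul, Nat.abs_cast]
    calc |h / D| * d ≤ 2 * |h| / Δ ^ 2 * d := by gcongr
      _ = _ := by ring
  · simp_rw [mul_assoc]
    rw [← Finset.mul_sum, inner_eq]
    have : -(h / D) * inner ℝ x q + h / D * d = h / D * D := by rw [hD]; ring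
    rw [this, div_mul_cancel₀ _ hDpos.ne']
  · simp_rw [mul_assoc]
    rw [← Finset.mul_sum, inner_eq, real_inner_self_eq_norm_sq, hq, hsq]
    ring

/-- The coefficient of an atom at distance at least `Δ` from all other atoms is controlled by the
kernel energy, uniformly in the positions of the atoms. -/
theorem exists_sq_coeff_le_integral {d : ℕ} (hd : 0 < d) {φ : ℝ → ℝ} (hφ : Continuous φ)
    {M : ℝ} (hM : ∀ t, |φ t| ≤ M) {a b : ℝ} (hab : φ a ≠ φ b) {Δ : ℝ} (hΔ : 0 < Δ)
    (ι : Type*) [Fintype ι] :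
    ∃ C₀ : ℝ, 0 < C₀ ∧ ∀ (x : EuclideanSpace ℝ (Fin d)) (q : ι → EuclideanSpace ℝ (Fin d)),
      ‖x‖ = √(d : ℝ) → (∀ i, ‖q i‖ = √(d : ℝ)) → (∀ i, Δ ≤ ‖x - q i‖) →
      ∀ (c : ℝ) (s : ι → ℝ),
        c ^ 2 ≤ C₀ * ∫ w, (c * φ (preact x w) + ∑ i, s i * φ (preact (q i) w)) ^ 2
          ∂rowLaw (0 : Fin d → ℝ) 0 1 := by
  obtain ⟨r, hr0, hr1, hne⟩ := exists_gaussSmooth_ne hφ hM hab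
  set Ψ := gaussSmooth φ r
  obtain ⟨h, t, hht⟩ := exists_fwdDiff_iter_ne_zero (abs_gaussSmooth_le hM r) hne (Fintype.card ι)
  set η := mixedDiff Ψ t (fun _ : ι => h) with hη
  have hη0 : η ≠ 0 := by
    rw [hη, mixedDiff_const_step]
    exact mul_ne_zero (by simp) hht
  set R : ℝ := 2 * d * |h| / Δ ^ 2
  have hR0 : 0 ≤ R := by positivity
  obtain ⟨B, hB⟩ := exists_rowLaw_le_smul hd hr0 hr1 (|t| + Fintype.card ι * R)
  refine ⟨(2 ^ Fintype.card ι * B) ^ 2 / η ^ 2 + 1, by positivity, fun x q hx hq hxq c s => ?_⟩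
  choose u τ hu hτ hux huq using fun i => exists_affineForm_vanishing hd hΔ h hx (hq i) (hxq i)
  set F : (Fin d → ℝ) × ℝ → ℝ := fun w => c * φ (preact x w) + ∑ i, s i * φ (preact (q i) w)
  have hFc : Continuous F := by fun_prop
  have hFb : ∀ w, ‖F w‖ ≤ |c| * M + ∑ i, |s i| * M := by
    intro w
    refine (norm_add_le _ _).trans (add_le_add ?_ ((norm_sum_le _ _).trans
      (Finset.sum_le_sum fun i _ => ?_)))
    · rw [norm_mul]; exact mul_le_mul_of_nonneg_left (hM _) (abs_nonneg _)
    · rw [norm_mul]; exact mul_le_mul_of_nonneg_left (hM _) (abs_nonneg _)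
  have hFint : ∀ (v : Fin d → ℝ) (σ : ℝ) (ρ : ℝ≥0), Integrable F (rowLaw v σ ρ) := fun v σ ρ =>
    Integrable.of_bound hFc.aestronglyMeasurable _ (Filter.Eventually.of_forall hFb)
  have hF2int : Integrable (fun w => F w ^ 2) (rowLaw (0 : Fin d → ℝ) 0 1) := by
    refine Integrable.of_bound (hFc.pow 2).aestronglyMeasurable
      ((|c| * M + ∑ i, |s i| * M) ^ 2) (Filter.Eventually.of_forall fun w => ?_)
    rw [norm_pow]
    exact pow_le_pow_left₀ (norm_nonneg _) (hFb w) 2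
  have hterm : ∀ (y : EuclideanSpace ℝ (Fin d)) (v : Fin d → ℝ) (σ : ℝ) (ρ : ℝ≥0),
      Integrable (fun w => φ (preact y w)) (rowLaw v σ ρ) := fun y v σ ρ =>
    Integrable.of_bound (hφ.comp (continuous_preact y)).aestronglyMeasurable M
      (Filter.Eventually.of_forall fun w => hM _)
  -- the mean of `F` under the row law shifted by the partial sums of the affine forms
  set U : Finset ι → Fin d → ℝ := fun A j => ∑ i ∈ A, u i j
  set T : Finset ι → ℝ := fun A => t + ∑ i ∈ A, τ i
  have hpt : ∀ (A : Finset ι) (y : EuclideanSpace ℝ (Fin d)),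
      ∑ j, U A j * y j + T A = t + ∑ i ∈ A, (∑ j, u i j * y j + τ i) := by
    intro A y
    simp only [U, T, Finset.sum_mul]
    rw [Finset.sum_comm, Finset.sum_add_distrib]
    ring
  have hmean : ∀ A : Finset ι, ∫ w, F w ∂rowLaw (U A) (T A) r =
      c * Ψ (t + ∑ i ∈ A, h) + ∑ k, s k * Ψ (t + ∑ i ∈ A, (∑ j, u i j * q k j + τ i)) := by
    intro A
    simp only [F]
    rw [integral_add ((hterm _ _ _ _).const_mul _)
        (integrable_finsetSum _ fun i _ => (hterm _ _ _ _).const_mul _),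
      integral_finsetSum _ fun i _ => (hterm _ _ _ _).const_mul _]
    simp_rw [integral_const_mul, integral_preact_rowLaw hd hφ _ _ _ hx,
      integral_preact_rowLaw hd hφ _ _ _ (hq _), hpt, hux]
    rfl
  -- in the alternating sum only the atom `x` survives
  have hsum : ∑ A : Finset ι, (-1) ^ A.card * ∫ w, F w ∂rowLaw (U A) (T A) r = c * η := by
    have hz : ∀ k, mixedDiff Ψ t (fun i => ∑ j, u i j * q k j + τ i) = 0 := fun k =>
      mixedDiff_eq_zero Ψ t _ (huq k)
    have e : c * η + ∑ k, s k * mixedDiff Ψ t (fun i => ∑ j, u i j * q k j + τ i) = c * η := by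
      simp [hz]
    rw [← e]
    simp only [hη, mixedDiff, hmean, mul_add, Finset.sum_add_distrib, Finset.mul_sum]
    congr 1
    · exact Finset.sum_congr rfl fun A _ => by ring
    · rw [Finset.sum_comm]
      exact Finset.sum_congr rfl fun A _ => Finset.sum_congr rfl fun k _ => by ring
  have hdom : ∀ A : Finset ι, |∫ w, F w ∂rowLaw (U A) (T A) r| ≤
      B * ∫ w, |F w| ∂rowLaw (0 : Fin d → ℝ) 0 1 := by
    intro A
    have hcard : (A.card : ℝ) ≤ Fintype.card ι := by exact_mod_cast Finset.card_le_univ A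
    have hle : ∀ g : ι → ℝ, (∀ i, |g i| ≤ R) → |∑ i ∈ A, g i| ≤ Fintype.card ι * R := by
      intro g hg
      calc |∑ i ∈ A, g i| ≤ ∑ i ∈ A, |g i| := Finset.abs_sum_le_sum_abs _ _
        _ ≤ ∑ i ∈ A, R := Finset.sum_le_sum fun i _ => hg i
        _ = A.card * R := by simp
        _ ≤ _ := by gcongr
    have hmeas := hB (U A) (T A)
      (fun j => (hle _ fun i => hu i j).trans (le_add_of_nonneg_left (abs_nonneg t)))
      ((abs_add_le _ _).trans (add_le_add le_rfl (hle _ hτ)))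
    refine abs_integral_le_integral_abs.trans ?_
    refine (integral_mono_measure hmeas (Filter.Eventually.of_forall fun w => abs_nonneg (F w))
      ?_).trans (le_of_eq ?_)
    · exact (hFint _ _ _).abs.smul_measure_nnreal
    · rw [integral_smul_nnreal_measure]; rfl
  set I := ∫ w, |F w| ∂rowLaw (0 : Fin d → ℝ) 0 1
  have hI0 : 0 ≤ I := integral_nonneg fun w => abs_nonneg _
  have hcη : |c * η| ≤ 2 ^ Fintype.card ι * B * I := by
    rw [← hsum]
    refine (Finset.abs_sum_le_sum_abs _ _).trans ?_
    refine (Finset.sum_le_sum (g := fun _ => (B : ℝ) * I) fun A _ => ?_).trans (le_of_eq ?_)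
    · rw [abs_mul, abs_pow, abs_neg, abs_one, one_pow, one_mul]; exact hdom A
    · simp [Fintype.card_finset, mul_assoc]
  have hJ : I ^ 2 ≤ ∫ w, F w ^ 2 ∂rowLaw (0 : Fin d → ℝ) 0 1 :=
    sq_integral_abs_le (hFint _ _ _) hF2int
  set J := ∫ w, F w ^ 2 ∂rowLaw (0 : Fin d → ℝ) 0 1
  have hJ0 : 0 ≤ J := (sq_nonneg I).trans hJ
  have h2 : c ^ 2 * η ^ 2 ≤ (2 ^ Fintype.card ι * B) ^ 2 * J := by
    calc c ^ 2 * η ^ 2 = |c * η| ^ 2 := by rw [sq_abs, mul_pow]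
      _ ≤ (2 ^ Fintype.card ι * B * I) ^ 2 := by gcongr
      _ = (2 ^ Fintype.card ι * B) ^ 2 * I ^ 2 := by ring
      _ ≤ _ := by gcongr
  have hη2 : 0 < η ^ 2 := by positivity
  calc c ^ 2 ≤ (2 ^ Fintype.card ι * B) ^ 2 / η ^ 2 * J := by
        rw [div_mul_eq_mul_div, le_div_iff₀ hη2]; exact h2
    _ ≤ _ := by nlinarith

theorem exists_card_le_of_separated {d : ℕ} {Δ : ℝ} (hΔ : 0 < Δ) :
    ∃ N : ℕ, ∀ (n : ℕ) (x : Fin n → EuclideanSpace ℝ (Fin d)), (∀ i, ‖x i‖ = √(d : ℝ)) →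
      (∀ i j, i ≠ j → Δ ≤ ‖x i - x j‖) → n ≤ N := by
  obtain ⟨t, ht, hcov⟩ := Metric.totallyBounded_iff.1
    (isCompact_closedBall (0 : EuclideanSpace ℝ (Fin d)) √(d : ℝ)).totallyBounded (Δ / 2)
    (half_pos hΔ)
  have := ht.fintype
  refine ⟨Fintype.card t, fun n x hx hsep => ?_⟩
  have hex : ∀ i, ∃ y : t, x i ∈ Metric.ball (y : EuclideanSpace ℝ (Fin d)) (Δ / 2) := by
    intro i
    have := hcov (show x i ∈ _ by simp [hx])
    simpa using this
  choose y hy using hex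
  have hinj : Function.Injective y := by
    intro i j hij
    by_contra hne
    have h1 := hy i
    have h2 := hy j
    rw [← hij] at h2
    have := dist_triangle_right (x i) (x j) (y i : EuclideanSpace ℝ (Fin d))
    rw [Metric.mem_ball] at h1 h2
    have h3 := hsep i j hne
    rw [← dist_eq_norm] at h3
    linarith
  simpa using Fintype.card_le_of_injective y hinj

end LowerBound

/-! ### Concentration, grids and moments -/

section Concentration

open scoped NNReal ENNReal

/-- Two-sided Hoeffding inequality for the mean of `p` independent copies of `f`. -/
theorem measureReal_abs_mean_sub_ge_le {Ω : Type*} [MeasurableSpace Ω] (μ : Measure Ω)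
    [IsProbabilityMeasure μ] {f : Ω → ℝ} (hf : Measurable f) {b : ℝ} (hb : ∀ w, |f w| ≤ b)
    {p : ℕ} (hp : 0 < p) {ε : ℝ} (hε : 0 ≤ ε) :
    (Measure.pi fun _ : Fin p => μ).real {W | ε ≤ |(∑ k, f (W k)) / p - ∫ w, f w ∂μ|} ≤
      2 * Real.exp (-(p * ε ^ 2) / (2 * b ^ 2)) := by
  have hp' : (0 : ℝ) < p := by exact_mod_cast hp
  set P := Measure.pi fun _ : Fin p => μ
  obtain ⟨w0⟩ : Nonempty Ω := by
    by_contra h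
    rw [not_nonempty_iff] at h
    exact IsProbabilityMeasure.ne_zero μ (Measure.eq_zero_of_isEmpty μ)
  have hb0 : 0 ≤ b := (abs_nonneg _).trans (hb w0)
  have one : ∀ g : Ω → ℝ, Measurable g → (∀ w, |g w| ≤ b) →
      P.real {W | p * ε ≤ ∑ k, (g (W k) - ∫ w, g w ∂μ)} ≤
        Real.exp (-(p * ε ^ 2) / (2 * b ^ 2)) := by
    intro g hg hgb
    have hsub : HasSubgaussianMGF (fun w => g w - μ[g]) ((‖b - -b‖₊ / 2) ^ 2) μ :=
      hasSubgaussianMGF_of_mem_Icc hg.aemeasurable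
        (Filter.Eventually.of_forall fun w => abs_le.1 (hgb w))
    have hind : iIndepFun (fun (k : Fin p) (W : Fin p → Ω) => g (W k) - μ[g]) P :=
      iIndepFun_pi (X := fun _ w => g w - μ[g]) fun _ => (hg.sub_const _).aemeasurable
    have hk : ∀ k ∈ (Finset.univ : Finset (Fin p)),
        HasSubgaussianMGF (fun W : Fin p → Ω => g (W k) - μ[g]) ((‖b - -b‖₊ / 2) ^ 2) P := by
      intro k _
      have hmp : P.map (fun W => W k) = μ :=
        (measurePreserving_eval (fun _ : Fin p => μ) k).map_eq
      have : HasSubgaussianMGF (fun w => g w - μ[g]) ((‖b - -b‖₊ / 2) ^ 2)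
          (P.map (fun W => W k)) := by rw [hmp]; exact hsub
      have hm : AEMeasurable (fun W : Fin p → Ω => W k) P :=
        (measurable_pi_apply k).aemeasurable
      exact HasSubgaussianMGF.of_map hm this
    have := HasSubgaussianMGF.measure_sum_ge_le_of_iIndepFun hind hk
      (ε := p * ε) (by positivity)
    refine this.trans (le_of_eq ?_)
    congr 1
    simp only [Finset.sum_const, Finset.card_univ, Fintype.card_fin, nsmul_eq_mul]
    push_cast
    have : ‖b - -b‖ / 2 = b := by
      rw [sub_neg_eq_add, Real.norm_of_nonneg (by linarith)]; ring
    rw [this]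
    rcases eq_or_ne b 0 with rfl | hb'
    · simp
    · field_simp
  have hsub : {W : Fin p → Ω | ε ≤ |(∑ k, f (W k)) / p - ∫ w, f w ∂μ|} ⊆
      {W | p * ε ≤ ∑ k, (f (W k) - ∫ w, f w ∂μ)} ∪
        {W | p * ε ≤ ∑ k, ((fun w => -f w) (W k) - ∫ w, -f w ∂μ)} := by
    intro W hW
    have e : ∑ k, (f (W k) - ∫ w, f w ∂μ) = p * ((∑ k, f (W k)) / p - ∫ w, f w ∂μ) := by
      rw [Finset.sum_sub_distrib]; simp; field_simp
    have e' : ∑ k, ((fun w => -f w) (W k) - ∫ w, -f w ∂μ) =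
        p * -((∑ k, f (W k)) / p - ∫ w, f w ∂μ) := by
      rw [mul_neg, ← e, integral_neg, ← Finset.sum_neg_distrib]
      exact Finset.sum_congr rfl fun k _ => by ring
    have hW' : ε ≤ |(∑ k, f (W k)) / p - ∫ w, f w ∂μ| := hW
    rcases le_abs.1 hW' with h | h
    · left
      rw [Set.mem_ofPred_eq, e]; gcongr
    · right
      rw [Set.mem_ofPred_eq, e']; gcongr
  refine (measureReal_mono hsub).trans ((measureReal_union_le _ _).trans ?_)
  rw [two_mul]
  exact add_le_add (one f hf hb) (one _ hf.neg fun w => by simpa using hb w)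

/-- The grid of mesh `r`; its points need not lie on the sphere. -/
theorem exists_grid (d : ℕ) {r : ℝ} (hr : 0 < r) :
    ∃ G : Finset (EuclideanSpace ℝ (Fin d)), (G.card : ℝ) ≤ (2 * √(d : ℝ) / r + 3) ^ d ∧
      ∀ x : EuclideanSpace ℝ (Fin d), ‖x‖ = √(d : ℝ) → ∃ g ∈ G, ∀ j, |x j - g j| ≤ r := by
  classical
  set m : ℕ := ⌈√(d : ℝ) / r⌉₊
  have hm : √(d : ℝ) / r ≤ m := Nat.le_ceil _
  have hm' : (m : ℝ) < √(d : ℝ) / r + 1 := Nat.ceil_lt_add_one (by positivity)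
  refine ⟨(Fintype.piFinset fun _ : Fin d => Finset.Icc (-(m : ℤ)) m).image
    fun k => WithLp.toLp 2 fun j => r * (k j : ℝ), ?_, fun x hx => ?_⟩
  · have h1 := Finset.card_image_le (s := Fintype.piFinset fun _ : Fin d => Finset.Icc (-(m : ℤ)) m)
      (f := fun k => (WithLp.toLp 2 fun j => r * (k j : ℝ) : EuclideanSpace ℝ (Fin d)))
    rw [Fintype.card_piFinset_const, Int.card_Icc] at h1
    have h2 : ((m : ℤ) + 1 - -(m : ℤ)).toNat = 2 * m + 1 := by omega
    rw [h2] at h1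
    refine (Nat.cast_le.2 h1).trans ?_
    push_cast
    have h3 : 2 * (m : ℝ) + 1 ≤ 2 * √(d : ℝ) / r + 3 := by rw [mul_div_assoc]; linarith
    exact pow_le_pow_left₀ (by positivity) h3 d
  · refine ⟨_, Finset.mem_image.2 ⟨fun j => ⌊x j / r⌋, ?_, rfl⟩, fun j => ?_⟩
    · rw [Fintype.mem_piFinset]
      intro j
      have hj : |x j| ≤ √(d : ℝ) := hx ▸ PiLp.norm_apply_le x j
      have hj' : |x j / r| ≤ m := by
        rw [abs_div, abs_of_pos hr]
        exact (div_le_div_of_nonneg_right hj hr.le).trans hm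
      rw [abs_le] at hj'
      rw [Finset.mem_Icc]
      refine ⟨Int.le_floor.2 (by push_cast; exact hj'.1), ?_⟩
      have : (⌊x j / r⌋ : ℝ) ≤ ((m : ℤ) : ℝ) := (Int.floor_le _).trans (by simpa using hj'.2)
      exact_mod_cast this
    · have h1 := Int.floor_le (x j / r)
      have h2 := Int.lt_floor_add_one (x j / r)
      have e : x j = r * (x j / r) := by field_simp
      simp only
      rw [abs_le]
      constructor <;> nlinarith

theorem integral_sum_abs_rowLaw_le {d : ℕ} (hd : 0 < d) :
    Integrable (fun w : (Fin d → ℝ) × ℝ => ∑ j, |w.1 j|) (rowLaw (0 : Fin d → ℝ) 0 1) ∧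
    ∫ w, ∑ j, |w.1 j| ∂rowLaw (0 : Fin d → ℝ) 0 1 ≤ √(d : ℝ) := by
  have hdR : (0 : ℝ) < d := by exact_mod_cast hd
  set ν := gaussianReal 0 (d : ℝ≥0)⁻¹
  have hmp : ∀ j, MeasurePreserving (fun w : (Fin d → ℝ) × ℝ => w.1 j)
      (rowLaw (0 : Fin d → ℝ) 0 1) ν := by
    intro j
    have h1 : MeasurePreserving (Prod.fst : (Fin d → ℝ) × ℝ → _) (rowLaw (0 : Fin d → ℝ) 0 1)
        (Measure.pi fun j : Fin d => gaussianReal ((0 : Fin d → ℝ) j) (1 * (d : ℝ≥0)⁻¹)) :=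
      measurePreserving_fst
    have h2 := (measurePreserving_eval
      (fun j : Fin d => gaussianReal ((0 : Fin d → ℝ) j) (1 * (d : ℝ≥0)⁻¹)) j).comp h1
    rw [one_mul] at h2
    exact h2
  have hsq : Integrable (fun y : ℝ => y ^ 2) ν := (memLp_id_gaussianReal 2).integrable_sq
  have hid : Integrable (fun y : ℝ => |y|) ν :=
    ((memLp_id_gaussianReal 1).integrable (by simp)).abs
  have hsqval : ∫ y, y ^ 2 ∂ν = (d : ℝ)⁻¹ := by
    have h := variance_fun_id_gaussianReal (μ := 0) (v := (d : ℝ≥0)⁻¹)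
    rw [variance_of_integral_eq_zero (by fun_prop) (by simp)] at h
    simpa using h
  have habs : ∫ y, |y| ∂ν ≤ 1 / √(d : ℝ) := by
    have hs : 0 < √(d : ℝ) := Real.sqrt_pos.2 hdR
    have hss : √(d : ℝ) * √(d : ℝ) = d := Real.mul_self_sqrt hdR.le
    calc ∫ y, |y| ∂ν ≤ ∫ y, (√(d : ℝ) / 2 * y ^ 2 + 1 / (2 * √(d : ℝ))) ∂ν := by
          -- arithmetic-geometric mean inequality
          refine integral_mono hid ((hsq.const_mul _).add (integrable_const _)) fun y => ?_
          have : √(d : ℝ) / 2 * y ^ 2 + 1 / (2 * √(d : ℝ)) - |y| =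
              (√(d : ℝ) * |y| - 1) ^ 2 / (2 * √(d : ℝ)) := by
            rw [← sq_abs y]; field_simp; ring
          have h0 : 0 ≤ (√(d : ℝ) * |y| - 1) ^ 2 / (2 * √(d : ℝ)) := by positivity
          simp only
          linarith
      _ = √(d : ℝ) / 2 * (d : ℝ)⁻¹ + 1 / (2 * √(d : ℝ)) := by
          rw [integral_add (hsq.const_mul _) (integrable_const _), integral_const_mul, hsqval]
          simp
      _ = 1 / √(d : ℝ) := by
          have : (d : ℝ)⁻¹ = (√(d : ℝ) * √(d : ℝ))⁻¹ := by rw [hss]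
          rw [this]; field_simp; norm_num
  have hint : ∀ j, Integrable (fun w : (Fin d → ℝ) × ℝ => |w.1 j|) (rowLaw (0 : Fin d → ℝ) 0 1) :=
    fun j => (hmp j).integrable_comp_of_integrable hid
  refine ⟨integrable_finsetSum _ fun j _ => hint j, ?_⟩
  rw [integral_finsetSum _ fun j _ => hint j]
  have hval : ∀ j, ∫ w, |w.1 j| ∂rowLaw (0 : Fin d → ℝ) 0 1 ≤ 1 / √(d : ℝ) := by
    intro j
    refine le_trans (le_of_eq ?_) habs
    rw [← (hmp j).map_eq, integral_map (hmp j).measurable.aemeasurable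
      (by fun_prop)]
  refine (Finset.sum_le_sum fun j _ => hval j).trans (le_of_eq ?_)
  simp only [Finset.sum_const, Finset.card_univ, Fintype.card_fin, nsmul_eq_mul]
  rw [mul_one_div, Real.div_sqrt]

end Concentration

/-! ### Uniform closeness of the empirical kernel -/

section UniformKernel

open scoped NNReal ENNReal

theorem abs_mul_preact_sub_le {d : ℕ} {φ : ℝ → ℝ} {M L : ℝ} (hM : ∀ t, |φ t| ≤ M)
    (hL : ∀ s t, |φ s - φ t| ≤ L * |s - t|) {r : ℝ}
    {x x' g g' : EuclideanSpace ℝ (Fin d)} (hx : ∀ j, |x j - g j| ≤ r)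
    (hx' : ∀ j, |x' j - g' j| ≤ r) (w : (Fin d → ℝ) × ℝ) :
    |φ (preact x w) * φ (preact x' w) - φ (preact g w) * φ (preact g' w)| ≤
      2 * M * L * r * ∑ j, |w.1 j| := by
  have hM0 : 0 ≤ M := (abs_nonneg _).trans (hM 0)
  have hL0 : 0 ≤ L := by
    have := (abs_nonneg _).trans (hL 1 0); simpa using this
  have hp : ∀ {y h : EuclideanSpace ℝ (Fin d)}, (∀ j, |y j - h j| ≤ r) →
      |φ (preact y w) - φ (preact h w)| ≤ L * (r * ∑ j, |w.1 j|) := by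
    intro y h hyh
    refine (hL _ _).trans (mul_le_mul_of_nonneg_left ?_ hL0)
    have e : preact y w - preact h w = ∑ j, w.1 j * (y j - h j) := by
      simp only [preact, mul_sub, Finset.sum_sub_distrib]; ring
    rw [e, Finset.mul_sum]
    refine (Finset.abs_sum_le_sum_abs _ _).trans (Finset.sum_le_sum fun j _ => ?_)
    rw [abs_mul, mul_comm]
    exact mul_le_mul_of_nonneg_right (hyh j) (abs_nonneg _)
  have e : φ (preact x w) * φ (preact x' w) - φ (preact g w) * φ (preact g' w) =
      φ (preact x w) * (φ (preact x' w) - φ (preact g' w)) +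
        (φ (preact x w) - φ (preact g w)) * φ (preact g' w) := by ring
  rw [e]
  refine (abs_add_le _ _).trans ?_
  rw [abs_mul, abs_mul]
  have h1 := mul_le_mul (hM (preact x w)) (hp hx') (abs_nonneg _) hM0
  have h2 := mul_le_mul (hp hx) (hM (preact g' w)) (abs_nonneg _) ((abs_nonneg _).trans (hp hx))
  linarith

theorem rfLaw_eq_pi_rowLaw (p d : ℕ) :
    rfLaw p d = Measure.pi fun _ : Fin p => rowLaw (0 : Fin d → ℝ) 0 1 := by
  simp [rfLaw, rowLaw]

/-- With probability at least `1 - δ` the empirical kernel is within `ε` of its mean, uniformly on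
the sphere. -/
theorem exists_event_kernel_close {d : ℕ} (hd : 0 < d) {φ : ℝ → ℝ} (hφ : Continuous φ) {M L : ℝ}
    (hM0 : 0 < M) (hL0 : 0 < L) (hM : ∀ t, |φ t| ≤ M) (hL : ∀ s t, |φ s - φ t| ≤ L * |s - t|)
    {p : ℕ} (hp : 0 < p) {δ ε : ℝ} (hδ : 0 < δ) (hδ1 : δ < 1) (hε : 0 < ε)
    (hN : 4 * (48 * d * M * L / (ε * δ) + 3) ^ (2 * d) ≤
      δ * Real.exp (p * ε ^ 2 / (8 * M ^ 4))) :
    ∃ E : Set (RFWeights p d), MeasurableSet E ∧ ENNReal.ofReal (1 - δ) ≤ rfLaw p d E ∧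
      ∀ W ∈ E, ∀ x x' : EuclideanSpace ℝ (Fin d), ‖x‖ = √(d : ℝ) → ‖x'‖ = √(d : ℝ) →
        |(∑ k, φ (preact x (W k)) * φ (preact x' (W k))) / p -
          ∫ w, φ (preact x w) * φ (preact x' w) ∂rowLaw (0 : Fin d → ℝ) 0 1| < ε := by
  have hdR : (0 : ℝ) < d := by exact_mod_cast hd
  have hpR : (0 : ℝ) < p := by exact_mod_cast hp
  have hs : 0 < √(d : ℝ) := Real.sqrt_pos.2 hdR
  have hss : √(d : ℝ) * √(d : ℝ) = d := Real.mul_self_sqrt hdR.le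
  rw [rfLaw_eq_pi_rowLaw]
  set μ := rowLaw (0 : Fin d → ℝ) 0 1 with hμ
  set P := Measure.pi fun _ : Fin p => μ
  set Q : (Fin d → ℝ) × ℝ → ℝ := fun w => ∑ j, |w.1 j| with hQ
  have hQc : Continuous Q := by fun_prop
  obtain ⟨hQint, hQle⟩ := integral_sum_abs_rowLaw_le hd
  -- for this mesh, passing to the grid costs at most `ε / 6 + ε δ / 12 < ε / 2`
  set r : ℝ := ε * δ / (24 * √(d : ℝ) * M * L) with hr
  have hr0 : 0 < r := by positivity
  obtain ⟨G, hGcard, hG⟩ := exists_grid d hr0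
  set ker : EuclideanSpace ℝ (Fin d) → EuclideanSpace ℝ (Fin d) → (Fin d → ℝ) × ℝ → ℝ :=
    fun x x' w => φ (preact x w) * φ (preact x' w) with hker
  have hkc : ∀ x x', Continuous (ker x x') := fun x x' => by fun_prop
  have hkb : ∀ x x' w, |ker x x' w| ≤ M ^ 2 := by
    intro x x' w
    rw [hker, abs_mul, sq]
    exact mul_le_mul (hM _) (hM _) (abs_nonneg _) hM0.le
  have hkint : ∀ x x', Integrable (ker x x') μ := fun x x' =>
    Integrable.of_bound (hkc x x').aestronglyMeasurable _ (Filter.Eventually.of_forall (hkb x x'))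
  set E₁ : Set (RFWeights p d) := {W | (∑ k, Q (W k)) / p < 2 * √(d : ℝ) / δ}
  set E₂ : EuclideanSpace ℝ (Fin d) × EuclideanSpace ℝ (Fin d) → Set (RFWeights p d) :=
    fun g => {W | |(∑ k, ker g.1 g.2 (W k)) / p - ∫ w, ker g.1 g.2 w ∂μ| < ε / 2}
  have hE₁ : MeasurableSet E₁ := by
    refine (isOpen_lt ?_ continuous_const).measurableSet
    fun_prop
  have hE₂ : ∀ g, MeasurableSet (E₂ g) := by
    intro g
    refine (isOpen_lt ?_ continuous_const).measurableSet
    have := hkc g.1 g.2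
    fun_prop
  have hE : MeasurableSet (E₁ ∩ ⋂ g ∈ G ×ˢ G, E₂ g) :=
    hE₁.inter (Finset.measurableSet_biInter _ fun g _ => hE₂ g)
  refine ⟨E₁ ∩ ⋂ g ∈ G ×ˢ G, E₂ g, hE, ?_, ?_⟩
  · -- Markov bound for the weights
    have hmark : P.real E₁ᶜ ≤ δ / 2 := by
      have hint : ∀ k : Fin p, Integrable (fun W : Fin p → (Fin d → ℝ) × ℝ => Q (W k)) P :=
        fun k => integrable_comp_eval (μ := fun _ : Fin p => μ) hQint
      have hval : ∫ W, (∑ k, Q (W k)) / p ∂P = ∫ w, Q w ∂μ := by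
        rw [integral_div, integral_finsetSum _ fun k _ => hint k]
        have : ∀ k : Fin p, ∫ W, Q (W k) ∂P = ∫ w, Q w ∂μ := fun k =>
          integral_comp_eval (μ := fun _ : Fin p => μ) hQc.aestronglyMeasurable
        simp [this]
        field_simp
      have hm := mul_meas_ge_le_integral_of_nonneg (μ := P)
        (f := fun W : Fin p → (Fin d → ℝ) × ℝ => (∑ k, Q (W k)) / p)
        (Filter.Eventually.of_forall fun W => by positivity)
        ((integrable_finsetSum _ fun k _ => hint k).div_const _) (2 * √(d : ℝ) / δ)
      rw [hval] at hm
      have hc : E₁ᶜ = {W | 2 * √(d : ℝ) / δ ≤ (∑ k, Q (W k)) / p} := by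
        ext W; simp [E₁]
      rw [hc]
      have h3 := hm.trans hQle
      rw [div_mul_eq_mul_div, div_le_iff₀ hδ] at h3
      nlinarith
    have hhoeff : ∀ g, P.real (E₂ g)ᶜ ≤ 2 * Real.exp (-(p * ε ^ 2 / (8 * M ^ 4))) := by
      intro g
      have h := measureReal_abs_mean_sub_ge_le μ (hkc g.1 g.2).measurable (hkb g.1 g.2) hp
        (half_pos hε).le
      have hc : (E₂ g)ᶜ = {W : Fin p → (Fin d → ℝ) × ℝ |
          ε / 2 ≤ |(∑ k, ker g.1 g.2 (W k)) / p - ∫ w, ker g.1 g.2 w ∂μ|} := by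
        ext W; simp [E₂]
      rw [hc]
      refine h.trans (le_of_eq ?_)
      congr 2
      field_simp
      ring
    have hcompl : P.real (E₁ ∩ ⋂ g ∈ G ×ˢ G, E₂ g)ᶜ ≤ δ := by
      have hsub : (E₁ ∩ ⋂ g ∈ G ×ˢ G, E₂ g)ᶜ ⊆ E₁ᶜ ∪ ⋃ g ∈ G ×ˢ G, (E₂ g)ᶜ := by
        rw [Set.compl_inter]; simp only [Set.compl_iInter]; exact subset_rfl
      refine (measureReal_mono hsub).trans ((measureReal_union_le _ _).trans ?_)
      have hU : P.real (⋃ g ∈ G ×ˢ G, (E₂ g)ᶜ) ≤ δ / 2 := by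
        refine (measureReal_biUnion_finset_le _ _).trans ?_
        refine (Finset.sum_le_sum fun g _ => hhoeff g).trans ?_
        rw [Finset.sum_const, Finset.card_product, nsmul_eq_mul]
        push_cast
        have hcard : (G.card : ℝ) * G.card ≤ (48 * d * M * L / (ε * δ) + 3) ^ (2 * d) := by
          have e : 2 * √(d : ℝ) / r = 48 * d * M * L / (ε * δ) := by
            rw [hr]; field_simp; rw [sq, hss]; ring
          rw [e] at hGcard
          rw [two_mul, pow_add]
          gcongr
        have hexp : 0 < Real.exp (p * ε ^ 2 / (8 * M ^ 4)) := Real.exp_pos _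
        rw [Real.exp_neg]
        have : (G.card : ℝ) * G.card * 4 ≤ δ * Real.exp (p * ε ^ 2 / (8 * M ^ 4)) := by linarith
        rw [← mul_assoc, ← div_eq_mul_inv, div_le_iff₀ hexp]
        linarith
      linarith
    have h1 : P.real (E₁ ∩ ⋂ g ∈ G ×ˢ G, E₂ g) = 1 - P.real (E₁ ∩ ⋂ g ∈ G ×ˢ G, E₂ g)ᶜ := by
      rw [probReal_compl_eq_one_sub hE]; ring
    refine ENNReal.ofReal_le_of_le_toReal ?_
    change 1 - δ ≤ P.real _
    rw [h1]; linarith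
  · rintro W ⟨hW₁, hW₂⟩ x x' hx hx'
    obtain ⟨g, hg, hxg⟩ := hG x hx
    obtain ⟨g', hg', hxg'⟩ := hG x' hx'
    have hW : |(∑ k, ker g g' (W k)) / p - ∫ w, ker g g' w ∂μ| < ε / 2 := by
      simp only [Set.mem_iInter] at hW₂
      exact hW₂ (g, g') (Finset.mk_mem_product hg hg')
    have hQW : (∑ k, Q (W k)) / p < 2 * √(d : ℝ) / δ := hW₁
    have hlip : ∀ w, |ker x x' w - ker g g' w| ≤ 2 * M * L * r * Q w := fun w =>
      abs_mul_preact_sub_le hM hL hxg hxg' w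
    have hA : |(∑ k, ker x x' (W k)) / p - (∑ k, ker g g' (W k)) / p| ≤
        2 * M * L * r * (2 * √(d : ℝ) / δ) := by
      rw [← sub_div, ← Finset.sum_sub_distrib, abs_div, Nat.abs_cast]
      calc |∑ k, (ker x x' (W k) - ker g g' (W k))| / p
          ≤ (∑ k, 2 * M * L * r * Q (W k)) / p := by
            gcongr
            exact (Finset.abs_sum_le_sum_abs _ _).trans
              (Finset.sum_le_sum fun k _ => hlip (W k))
        _ = 2 * M * L * r * ((∑ k, Q (W k)) / p) := by rw [← Finset.mul_sum]; ring
        _ ≤ _ := by gcongr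
    have hB : |∫ w, ker x x' w ∂μ - ∫ w, ker g g' w ∂μ| ≤ 2 * M * L * r * √(d : ℝ) := by
      rw [← integral_sub (hkint _ _) (hkint _ _)]
      refine abs_integral_le_integral_abs.trans ?_
      calc ∫ w, |ker x x' w - ker g g' w| ∂μ ≤ ∫ w, 2 * M * L * r * Q w ∂μ :=
            integral_mono ((hkint _ _).sub (hkint _ _)).abs (hQint.const_mul _) hlip
        _ = 2 * M * L * r * ∫ w, Q w ∂μ := integral_const_mul _ _
        _ ≤ _ := by gcongr
    have hA' : 2 * M * L * r * (2 * √(d : ℝ) / δ) = ε / 6 := by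
      rw [hr]; field_simp; norm_num
    have hB' : 2 * M * L * r * √(d : ℝ) = ε * δ / 12 := by
      rw [hr]; field_simp; norm_num
    rw [hA'] at hA
    rw [hB'] at hB
    have hεδ : ε * δ < ε := by nlinarith
    rw [abs_lt] at hW ⊢
    rw [abs_le] at hA hB
    constructor <;> linarith [hW.1, hW.2, hA.1, hA.2, hB.1, hB.2]

/-- If the neurons of `W` all annihilate the measure `∑ i, s i • δ (q i)`, then its energy for the
empirical kernel is zero, and its energy for the mean kernel is small. -/
theorem integral_sq_le_of_kernel_close {d p : ℕ} {φ : ℝ → ℝ} (hφ : Continuous φ)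
    {M : ℝ} (hM : ∀ t, |φ t| ≤ M) {ι : Type*} [Fintype ι] (q : ι → EuclideanSpace ℝ (Fin d))
    (s : ι → ℝ) (W : RFWeights p d) {ε : ℝ}
    (hclose : ∀ i i', |(∑ k, φ (preact (q i) (W k)) * φ (preact (q i') (W k))) / p -
      ∫ w, φ (preact (q i) w) * φ (preact (q i') w) ∂rowLaw (0 : Fin d → ℝ) 0 1| < ε)
    (hzero : ∀ k, ∑ i, s i * φ (preact (q i) (W k)) = 0) :
    ∫ w, (∑ i, s i * φ (preact (q i) w)) ^ 2 ∂rowLaw (0 : Fin d → ℝ) 0 1 ≤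
      (∑ i, |s i|) ^ 2 * ε := by
  set μ := rowLaw (0 : Fin d → ℝ) 0 1
  have hM0 : 0 ≤ M := (abs_nonneg _).trans (hM 0)
  have hexp : ∀ w, (∑ i, s i * φ (preact (q i) w)) ^ 2 =
      ∑ i, ∑ i', s i * s i' * (φ (preact (q i) w) * φ (preact (q i') w)) := by
    intro w
    rw [sq, Finset.sum_mul_sum]
    exact Finset.sum_congr rfl fun i _ => Finset.sum_congr rfl fun i' _ => by ring
  have hint : ∀ i i', Integrable (fun w => s i * s i' *
      (φ (preact (q i) w) * φ (preact (q i') w))) μ := by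
    intro i i'
    refine Integrable.const_mul (Integrable.of_bound (by fun_prop) (M * M)
      (Filter.Eventually.of_forall fun w => ?_)) _
    rw [norm_mul]
    exact mul_le_mul (hM _) (hM _) (abs_nonneg _) hM0
  have hemp : ∑ i, ∑ i', s i * s i' *
      ((∑ k, φ (preact (q i) (W k)) * φ (preact (q i') (W k))) / p) = 0 := by
    have h : ∑ k, (∑ i, s i * φ (preact (q i) (W k))) ^ 2 = 0 := by simp [hzero]
    simp_rw [hexp] at h
    rw [Finset.sum_comm] at h
    simp_rw [Finset.sum_comm (s := (Finset.univ : Finset (Fin p))), ← Finset.mul_sum] at h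
    simp_rw [mul_div_assoc', ← Finset.sum_div]
    rw [h, zero_div]
  simp_rw [hexp]
  rw [integral_finsetSum _ fun i _ => integrable_finsetSum _ fun i' _ => hint i i']
  simp_rw [integral_finsetSum _ fun i' _ => hint _ i', integral_const_mul]
  rw [← sub_zero (∑ i, ∑ i', _), ← hemp, ← Finset.sum_sub_distrib]
  simp_rw [← Finset.sum_sub_distrib, ← mul_sub]
  rw [sq, Finset.sum_mul_sum, Finset.sum_mul]
  refine Finset.sum_le_sum fun i _ => ?_
  rw [Finset.sum_mul]
  refine Finset.sum_le_sum fun i' _ => ?_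
  refine (le_abs_self _).trans ?_
  rw [abs_mul, abs_mul, abs_sub_comm]
  exact mul_le_mul_of_nonneg_left (hclose i i').le (by positivity)

end UniformKernel

/-! ### Reconstruction of a training point -/

section Reconstruction

theorem gradient_rfModel {p d : ℕ} (φ : ℝ → ℝ) (W : RFWeights p d)
    (x : EuclideanSpace ℝ (Fin d)) (θ : EuclideanSpace ℝ (Fin p)) :
    gradient (rfModel φ W x) θ = rfFeature φ W x := by
  refine HasGradientAt.gradient ?_
  rw [hasGradientAt_iff_hasFDerivAt]
  exact ((InnerProductSpace.toDual ℝ (EuclideanSpace ℝ (Fin p))) (rfFeature φ W x)).hasFDerivAt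

theorem trainedParam_eq_sum {n p d : ℕ} (φ : ℝ → ℝ) (W : RFWeights p d)
    (x : Fin n → EuclideanSpace ℝ (Fin d)) (y : Fin n → ℝ) :
    trainedParam φ W x y = ∑ i, interpCoeff φ W x y i • rfFeature φ W (x i) := by
  ext k
  simp [trainedParam, featureMatrix, Matrix.mulVec, dotProduct, mul_comm]

/-- The training set with the coefficients `α` has zero reconstruction loss, so every optimal
solution represents `θ*` exactly. -/
theorem IsReconOptimal.sum_smul_rfFeature_eq {n p d : ℕ} {φ : ℝ → ℝ} {W : RFWeights p d}
    {x : Fin n → EuclideanSpace ℝ (Fin d)} {y : Fin n → ℝ} (hx : ∀ i, ‖x i‖ = √(d : ℝ))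
    {z : Fin n → EuclideanSpace ℝ (Fin d)} {a : Fin n → ℝ}
    (h : IsReconOptimal (rfModel φ W) 0 (trainedParam φ W x y) z a) :
    ∑ i, a i • rfFeature φ W (z i) = ∑ i, interpCoeff φ W x y i • rfFeature φ W (x i) := by
  have h0 := h.2 x (interpCoeff φ W x y) hx
  simp only [reconLoss, gradient_rfModel, sub_zero] at h0
  rw [← trainedParam_eq_sum] at h0 ⊢
  rw [sub_self, norm_zero, zero_pow two_ne_zero] at h0
  have h1 : trainedParam φ W x y - ∑ i, a i • rfFeature φ W (z i) = 0 := by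
    rw [← norm_eq_zero, ← sq_eq_zero_iff]
    exact le_antisymm h0 (sq_nonneg _)
  exact (sub_eq_zero.1 h1).symm

theorem sum_mul_preact_eq {n p d : ℕ} (hp : 0 < p) {φ : ℝ → ℝ} {W : RFWeights p d}
    {x z : Fin n → EuclideanSpace ℝ (Fin d)} {a b : Fin n → ℝ}
    (h : ∑ i, a i • rfFeature φ W (z i) = ∑ i, b i • rfFeature φ W (x i)) (k : Fin p) :
    ∑ i, a i * φ (preact (z i) (W k)) = ∑ i, b i * φ (preact (x i) (W k)) := by
  have hk := congrArg (fun v : EuclideanSpace ℝ (Fin p) => v k) h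
  have e : ∀ (c : Fin n → ℝ) (y : Fin n → EuclideanSpace ℝ (Fin d)),
      (∑ i, c i • rfFeature φ W (y i)) k = 1 / √(p : ℝ) * ∑ i, c i * φ (preact (y i) (W k)) := by
    intro c y
    simp only [WithLp.ofLp_sum, Finset.sum_apply, PiLp.smul_apply, rfFeature, smul_eq_mul,
      Finset.mul_sum, preact]
    exact Finset.sum_congr rfl fun i _ => by ring
  simp only [e] at hk
  have hp' : (1 / √(p : ℝ)) ≠ 0 := by
    have : (0 : ℝ) < p := by exact_mod_cast hp
    positivity
  exact mul_left_cancel₀ hp' hk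

/-- The deterministic part: `hlow` is the lower bound for the kernel energy and `hclose` the
uniform closeness of the empirical kernel. -/
theorem exists_dist_lt_of_kernel_close {n p d : ℕ} (hp : 0 < p) {φ : ℝ → ℝ} (hφ : Continuous φ)
    {M : ℝ} (hM : ∀ t, |φ t| ≤ M) {Δ C₀ ε c : ℝ} (hc : 0 < c) (hC₀ : 0 < C₀)
    (hlow : ∀ (x : EuclideanSpace ℝ (Fin d)) (q : Fin n ⊕ Fin n → EuclideanSpace ℝ (Fin d)),
      ‖x‖ = √(d : ℝ) → (∀ i, ‖q i‖ = √(d : ℝ)) → (∀ i, Δ ≤ ‖x - q i‖) →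
      ∀ (c : ℝ) (s : Fin n ⊕ Fin n → ℝ),
        c ^ 2 ≤ C₀ * ∫ w, (c * φ (preact x w) + ∑ i, s i * φ (preact (q i) w)) ^ 2
          ∂rowLaw (0 : Fin d → ℝ) 0 1)
    {x z : Fin n → EuclideanSpace ℝ (Fin d)} {a b : Fin n → ℝ}
    (hx : ∀ i, ‖x i‖ = √(d : ℝ)) (hz : ∀ i, ‖z i‖ = √(d : ℝ))
    (hsep : ∀ i j, i ≠ j → Δ ≤ ‖x i - x j‖) (hb : ∀ i, c ≤ |b i|) {W : RFWeights p d}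
    (hclose : ∀ x x' : EuclideanSpace ℝ (Fin d), ‖x‖ = √(d : ℝ) → ‖x'‖ = √(d : ℝ) →
      |(∑ k, φ (preact x (W k)) * φ (preact x' (W k))) / p -
        ∫ w, φ (preact x w) * φ (preact x' w) ∂rowLaw (0 : Fin d → ℝ) 0 1| < ε)
    (h : ∑ i, a i • rfFeature φ W (z i) = ∑ i, b i • rfFeature φ W (x i))
    (hε : C₀ * ((l1norm b + l1norm a) ^ 2 * ε) < c ^ 2) (j : Fin n) :
    ∃ i, ‖x j - z i‖ < Δ := by
  by_contra! hfar
  set q : Fin n ⊕ Fin n → EuclideanSpace ℝ (Fin d) := Sum.elim x z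
  set s : Fin n ⊕ Fin n → ℝ := Sum.elim b fun i => -a i
  have hq : ∀ i, ‖q i‖ = √(d : ℝ) := by rintro (i | i); exacts [hx i, hz i]
  have hs1 : ∑ i, |s i| = l1norm b + l1norm a := by
    simp [s, l1norm, Fintype.sum_sum_type]
  have hupper := integral_sq_le_of_kernel_close hφ hM q s W
    (fun i i' => hclose _ _ (hq i) (hq i')) fun k => by
      simp [s, q, Fintype.sum_sum_type, sum_mul_preact_eq hp h k]
  rw [hs1] at hupper
  -- replace the atom at `x j` by a zero coefficient at a point far from `x j`
  have hl := hlow (x j) (Sum.elim (Function.update x j (z j)) z) (hx j)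
    (by
      rintro (i | i)
      · rcases eq_or_ne i j with rfl | hij
        · simp [hz]
        · simp [hij, hx]
      · exact hz i)
    (by
      rintro (i | i)
      · rcases eq_or_ne i j with rfl | hij
        · simpa using hfar i
        · simpa [hij] using hsep j i hij.symm
      · exact hfar i)
    (b j) (Sum.elim (Function.update b j 0) fun i => -a i)
  have hsplit : ∀ w, b j * φ (preact (x j) w) + ∑ i, Sum.elim (Function.update b j 0)
      (fun i => -a i) i * φ (preact (Sum.elim (Function.update x j (z j)) z i) w) =
      ∑ i, s i * φ (preact (q i) w) := by
    intro w
    simp only [s, q, Fintype.sum_sum_type, Sum.elim_inl, Sum.elim_inr]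
    rw [← add_assoc]
    congr 1
    rw [← Finset.add_sum_erase _ _ (Finset.mem_univ j),
      ← Finset.add_sum_erase (a := j) _ (fun i => b i * φ (preact (x i) w)) (Finset.mem_univ j)]
    simp only [Function.update_self, zero_mul, zero_add]
    congr 1
    refine Finset.sum_congr rfl fun i hi => ?_
    rw [Function.update_of_ne (Finset.ne_of_mem_erase hi),
      Function.update_of_ne (Finset.ne_of_mem_erase hi)]
  simp_rw [hsplit] at hl
  have hcb : c ^ 2 ≤ b j ^ 2 := by
    rw [← sq_abs (b j)]; exact pow_le_pow_left₀ hc.le (hb j) 2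
  have := hl.trans (mul_le_mul_of_nonneg_left hupper hC₀.le)
  linarith

end Reconstruction

/-! ### The width condition -/

section Width

theorem one_half_le_log {x : ℝ} (hx : 6 ≤ x) : 1 / 2 ≤ Real.log x := by
  have h := Real.one_sub_inv_le_log_of_pos (x := x) (by linarith)
  have : x⁻¹ ≤ 1 / 2 := by rw [inv_le_comm₀ (by linarith) (by norm_num)]; linarith
  linarith

/-- With `ε = c² / (κ S²)`, the width condition gives the numerical hypothesis of
`exists_event_kernel_close`, that is, it pays for the union bound over the grid. -/
theorem union_bound_of_width {d : ℕ} (hd : 0 < d) {δ κ C M L c S p : ℝ} (hδ : 0 < δ) (hδ1 : δ < 1)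
    (hκ : 0 < κ) (hM : 0 < M) (hL : 0 < L) (hc : 0 < c) (hS : 0 < S)
    (hC : 2 * d ^ 2 * κ ≤ C)
    (hR : 1 ≤ 24 * C * L * M * S ^ 2 / (√(d : ℝ) * c ^ 2))
    (hp : p ≥ 128 * C ^ 2 * M ^ 4 * (2 * d + 1) * S ^ 4 / c ^ 4 *
      (Real.log ((2 + 4 * d) / δ) + (2 * d : ℝ) / (2 * d + 1) *
        Real.log (24 * C * L * M * S ^ 2 / (√(d : ℝ) * c ^ 2)))) :
    4 * (48 * d * M * L / (c ^ 2 / (κ * S ^ 2) * δ) + 3) ^ (2 * d) ≤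
      δ * Real.exp (p * (c ^ 2 / (κ * S ^ 2)) ^ 2 / (8 * M ^ 4)) := by
  have hd1 : (1 : ℝ) ≤ d := by exact_mod_cast hd
  have hs : 0 < √(d : ℝ) := Real.sqrt_pos.2 (by linarith)
  have hsd : √(d : ℝ) ≤ d := by rw [Real.sqrt_le_left (by positivity)]; nlinarith
  have hκC : κ ≤ C := by nlinarith [mul_le_mul_of_nonneg_right (one_le_pow₀ hd1 (n := 2)) hκ.le]
  have hC0 : 0 < C := hκ.trans_le hκC
  set X : ℝ := 24 * C * L * M * S ^ 2 / (√(d : ℝ) * c ^ 2) with hX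
  set Y : ℝ := 6 / δ with hY
  have hX0 : 0 < X := by linarith
  have hY6 : 6 ≤ Y := by rw [hY, le_div_iff₀ hδ]; linarith
  have hlX : 0 ≤ Real.log X := Real.log_nonneg hR
  have hlY : 0 ≤ Real.log Y := Real.log_nonneg (by linarith)
  have hlog : Real.log Y ≤ Real.log ((2 + 4 * d) / δ) := by
    refine Real.log_le_log (by positivity) ?_
    rw [hY]; gcongr; linarith
  -- the radius of the grid is controlled by `X / δ`
  have hbase : 48 * d * M * L / (c ^ 2 / (κ * S ^ 2) * δ) + 3 ≤ X * Y := by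
    have h1 : 48 * d * M * L / (c ^ 2 / (κ * S ^ 2) * δ) ≤ X / δ := by
      have e1 : 48 * d * M * L / (c ^ 2 / (κ * S ^ 2) * δ) =
          (24 * L * M * S ^ 2 / (√(d : ℝ) * c ^ 2 * δ)) * (2 * d * √(d : ℝ) * κ) := by
        field_simp; norm_num
      have e2 : X / δ = (24 * L * M * S ^ 2 / (√(d : ℝ) * c ^ 2 * δ)) * C := by
        rw [hX]; field_simp
      rw [e1, e2]
      refine mul_le_mul_of_nonneg_left (le_trans ?_ hC) (by positivity)
      have : 2 * d * √(d : ℝ) * κ ≤ 2 * d * d * κ := by gcongr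
      linarith
    have h2 : X * Y = X / δ + 5 * (X / δ) := by rw [hY]; ring
    have h3 : 1 ≤ X / δ := by rw [le_div_iff₀ hδ]; linarith
    linarith
  have hexp : 2 * (2 * d + 1) * Real.log Y + 2 * d * Real.log X ≤
      p * (c ^ 2 / (κ * S ^ 2)) ^ 2 / (8 * M ^ 4) := by
    set B : ℝ := Real.log ((2 + 4 * d) / δ) + (2 * d : ℝ) / (2 * d + 1) * Real.log X with hB
    have hB1 : (2 * d + 1) * B =
        (2 * d + 1) * Real.log ((2 + 4 * d) / δ) + 2 * d * Real.log X := by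
      rw [hB]; field_simp
    have hB0 : 0 ≤ (2 * d + 1) * B := by
      rw [hB1]
      have := hlY.trans hlog
      positivity
    have h1 : (C / κ) ^ 2 * (16 * ((2 * d + 1) * B)) ≤
        p * (c ^ 2 / (κ * S ^ 2)) ^ 2 / (8 * M ^ 4) := by
      have e : (C / κ) ^ 2 * (16 * ((2 * d + 1) * B)) =
          (128 * C ^ 2 * M ^ 4 * (2 * d + 1) * S ^ 4 / c ^ 4 * B) *
            (c ^ 2 / (κ * S ^ 2)) ^ 2 / (8 * M ^ 4) := by
        field_simp; ring
      rw [e]; gcongr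
    have h2 : 1 ≤ (C / κ) ^ 2 := one_le_pow₀ ((one_le_div hκ).2 hκC)
    have h3 : 16 * ((2 * d + 1) * B) ≤ (C / κ) ^ 2 * (16 * ((2 * d + 1) * B)) :=
      le_mul_of_one_le_left (by positivity) h2
    have h4 : (2 * d + 1) * Real.log Y ≤ (2 * d + 1) * Real.log ((2 + 4 * d) / δ) := by gcongr
    have h5 : 0 ≤ 2 * d * Real.log X := by positivity
    have h6 : 0 ≤ (2 * d + 1) * Real.log Y := by positivity
    linarith
  have hE : Y ^ (2 * (2 * d + 1)) * X ^ (2 * d) ≤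
      Real.exp (p * (c ^ 2 / (κ * S ^ 2)) ^ 2 / (8 * M ^ 4)) := by
    refine le_trans (le_of_eq ?_) (Real.exp_le_exp.2 hexp)
    have e1 : 2 * (2 * (d : ℝ) + 1) * Real.log Y = ((2 * (2 * d + 1) : ℕ) : ℝ) * Real.log Y := by
      push_cast; ring
    have e2 : 2 * (d : ℝ) * Real.log X = ((2 * d : ℕ) : ℝ) * Real.log X := by push_cast; ring
    rw [Real.exp_add, e1, e2, Real.exp_nat_mul, Real.exp_nat_mul, Real.exp_log hX0,
      Real.exp_log (by linarith)]
  have hY1 : (1 : ℝ) ≤ Y ^ (2 * d + 1) := one_le_pow₀ (by linarith)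
  calc 4 * (48 * d * M * L / (c ^ 2 / (κ * S ^ 2) * δ) + 3) ^ (2 * d)
      ≤ 4 * (X * Y) ^ (2 * d) := by gcongr
    _ ≤ (δ * Y * Y ^ (2 * d + 1)) * (X * Y) ^ (2 * d) := by
        gcongr
        have : δ * Y = 6 := by rw [hY]; field_simp
        rw [this]; linarith
    _ = δ * (Y ^ (2 * (2 * d + 1)) * X ^ (2 * d)) := by rw [mul_pow]; ring
    _ ≤ _ := by gcongr

end Width

theorem theorem1 (d : ℕ) (hd : 0 < d) (φ : ℝ → ℝ)
    (hφ_cont : Continuous φ) (hφ_diff : Differentiable ℝ φ)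
    (hφ_poly : ¬ ∃ q : Polynomial ℝ, ∀ t, φ t = q.eval t)
    (Δ : ℝ) (hΔ : 0 < Δ) :
    ∃ C : ℝ, 0 < C ∧
      ∀ M L : ℝ, (∀ t, |φ t| ≤ M) → (∀ t, |deriv φ t| ≤ L) →
      ∀ (n : ℕ) (x : Fin n → EuclideanSpace ℝ (Fin d)) (y : Fin n → ℝ),
        (∀ i, ‖x i‖ = √(d : ℝ)) → (∀ i j, i ≠ j → Δ ≤ ‖x i - x j‖) →
      ∀ (c δ : ℝ), 0 < c → 0 < δ →
      ∀ p : ℕ, ∃ E : Set (RFWeights p d),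
        MeasurableSet E ∧ ENNReal.ofReal (1 - δ) ≤ rfLaw p d E ∧
        ∀ W ∈ E,
          IsUnit (gramMatrix φ W x) →
          (∀ i, c ≤ |interpCoeff φ W x y i|) →
          ∀ (z : Fin n → EuclideanSpace ℝ (Fin d)) (a : Fin n → ℝ),
            IsReconOptimal (rfModel φ W) 0 (trainedParam φ W x y) z a →
            δ ≤ 16 * C * (1 + 2 * d) * L * M *
                ((l1norm (interpCoeff φ W x y) + l1norm a) ^ 2 / (√(d : ℝ) * c ^ 2)) →
            (p : ℝ) ≥ 128 * C ^ 2 * M ^ 4 * (2 * d + 1) *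
                  (l1norm (interpCoeff φ W x y) + l1norm a) ^ 4 / c ^ 4 *
                (Real.log ((2 + 4 * d) / δ) + (2 * d : ℝ) / (2 * d + 1) *
                  Real.log (24 * C * L * M * (l1norm (interpCoeff φ W x y) + l1norm a) ^ 2 /
                    (√(d : ℝ) * c ^ 2))) →
            ∀ j, ∃ i, ‖x j - z i‖ < Δ := by
  by_cases hbdd : ∃ M, ∀ t, |φ t| ≤ M
  swap
  -- for an unbounded `φ` there is no `M`
  · exact ⟨1, one_pos, fun M L hM => absurd ⟨M, hM⟩ hbdd⟩
  obtain ⟨M₀, hM₀⟩ := hbdd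
  obtain ⟨t₁, t₂, hne⟩ : ∃ a b, φ a ≠ φ b := by
    by_contra! H
    exact hφ_poly ⟨Polynomial.C (φ 0), fun t => by simpa using H t 0⟩
  obtain ⟨t₀, ht₀⟩ : ∃ t, φ t ≠ 0 := by
    by_contra! H
    exact hne (by rw [H, H])
  obtain ⟨u₀, hu₀⟩ : ∃ t, deriv φ t ≠ 0 := by
    by_contra! H
    exact hne (is_const_of_deriv_eq_zero hφ_diff H t₁ t₂)
  have hdR : (1 : ℝ) ≤ d := by exact_mod_cast hd
  have hs : 0 < √(d : ℝ) := Real.sqrt_pos.2 (by linarith)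
  obtain ⟨N, hN⟩ := exists_card_le_of_separated (d := d) hΔ
  choose K hK0 hK using fun n : ℕ =>
    exists_sq_coeff_le_integral hd hφ_cont hM₀ hne hΔ (Fin n ⊕ Fin n)
  set C₀ : ℝ := ∑ n ∈ Finset.range (N + 1), K n with hC₀
  have hKC : ∀ n ≤ N, K n ≤ C₀ := fun n hn =>
    Finset.single_le_sum (f := K) (fun i _ => (hK0 i).le) (Finset.mem_range.2 (by omega))
  have hC₀0 : 0 < C₀ := (hK0 0).trans_le (hKC 0 (Nat.zero_le N))
  -- `8` makes up for the factor `(2 * S)²` with a strict inequality left over; the second summand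
  -- makes the logarithm of `X` below nonnegative
  set C : ℝ := 2 * d ^ 2 * (8 * C₀) + √(d : ℝ) / (|deriv φ u₀| * |φ t₀|) with hCdef
  have hC1 : 2 * (d : ℝ) ^ 2 * (8 * C₀) ≤ C := le_add_of_nonneg_right (by positivity)
  have hC0 : 0 < C := by positivity
  refine ⟨C, hC0, fun M L hM hL n x y hx hsep c δ hc hδ p => ?_⟩
  have hM0 : 0 < M := (abs_pos.2 ht₀).trans_le (hM t₀)
  have hL0 : 0 < L := (abs_pos.2 hu₀).trans_le (hL u₀)
  have hlip : ∀ s t, |φ s - φ t| ≤ L * |s - t| := fun s t =>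
    Convex.norm_image_sub_le_of_norm_deriv_le (fun x _ => hφ_diff x) (fun x _ => hL x)
      convex_univ (Set.mem_univ t) (Set.mem_univ s)
  rcases le_or_gt 1 δ with hδ1 | hδ1
  · exact ⟨∅, MeasurableSet.empty, by simp [hδ1], fun W hW => absurd hW (Set.notMem_empty W)⟩
  set X : ℝ → ℝ := fun S => 24 * C * L * M * S ^ 2 / (√(d : ℝ) * c ^ 2) with hX
  set F : ℝ → ℝ := fun S => 128 * C ^ 2 * M ^ 4 * (2 * d + 1) * S ^ 4 / c ^ 4 *
    (Real.log ((2 + 4 * d) / δ) + (2 * d : ℝ) / (2 * d + 1) * Real.log (X S)) with hF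
  have hX1 : ∀ S, c ≤ S → 1 ≤ X S := by
    intro S hS
    have h1 : √(d : ℝ) ≤ C * (L * M) := by
      have h2 : √(d : ℝ) / (|deriv φ u₀| * |φ t₀|) ≤ C := le_add_of_nonneg_left (by positivity)
      rw [div_le_iff₀ (by positivity)] at h2
      refine h2.trans ?_
      gcongr
      exacts [hL u₀, hM t₀]
    have h3 : c ^ 2 ≤ S ^ 2 := by gcongr
    rw [hX]
    simp only
    rw [le_div_iff₀ (by positivity), one_mul]
    calc √(d : ℝ) * c ^ 2 ≤ (C * (L * M)) * S ^ 2 := by gcongr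
      _ ≤ 24 * ((C * (L * M)) * S ^ 2) := by
        have : 0 ≤ (C * (L * M)) * S ^ 2 := by positivity
        linarith
      _ = _ := by ring
  have hF1 : ∀ S, c ≤ S → 64 * C ^ 2 * M ^ 4 * (2 * d + 1) / c * S ≤ F S := by
    intro S hS
    have hS0 : 0 < S := hc.trans_le hS
    have hb : 1 / 2 ≤ Real.log ((2 + 4 * d) / δ) +
        (2 * d : ℝ) / (2 * d + 1) * Real.log (X S) := by
      have h1 : 1 / 2 ≤ Real.log ((2 + 4 * d) / δ) :=
        one_half_le_log (by rw [le_div_iff₀ hδ]; linarith)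
      have h2 := Real.log_nonneg (hX1 S hS)
      have h3 : 0 ≤ (2 * d : ℝ) / (2 * d + 1) * Real.log (X S) := by positivity
      linarith
    calc 64 * C ^ 2 * M ^ 4 * (2 * d + 1) / c * S
        = 128 * C ^ 2 * M ^ 4 * (2 * d + 1) * (c ^ 3 * S) / c ^ 4 * (1 / 2) := by
          field_simp; norm_num
      _ ≤ 128 * C ^ 2 * M ^ 4 * (2 * d + 1) * (S ^ 3 * S) / c ^ 4 * (1 / 2) := by gcongr
      _ = 128 * C ^ 2 * M ^ 4 * (2 * d + 1) * S ^ 4 / c ^ 4 * (1 / 2) := by ring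
      _ ≤ F S := mul_le_mul_of_nonneg_left hb (by positivity)
  have hl1 : ∀ {α a : Fin n → ℝ}, (∀ i, c ≤ |α i|) → Fin n → c ≤ l1norm α + l1norm a := by
    intro α a hα j
    have h1 : |α j| ≤ l1norm α :=
      Finset.single_le_sum (f := fun i => |α i|) (fun i _ => abs_nonneg _) (Finset.mem_univ j)
    have h2 : 0 ≤ l1norm a := Finset.sum_nonneg fun i _ => abs_nonneg _
    linarith [hα j]
  -- the values of `‖α‖₁ + ‖α̂‖₁` for which the width `p` is admissible
  set A : Set ℝ := {S | c ≤ S ∧ F S ≤ p} with hA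
  rcases A.eq_empty_or_nonempty with hempty | hnonempty
  · refine ⟨Set.univ, MeasurableSet.univ, ?_, fun W _ _ hα z a _ _ hp j => ?_⟩
    · rw [rfLaw_eq_pi_rowLaw, measure_univ]
      exact ENNReal.ofReal_le_one.2 (by linarith)
    · exact absurd (show l1norm (interpCoeff φ W x y) + l1norm a ∈ A from ⟨hl1 hα j, hp⟩)
        (by simp [hempty])
  · have hbddA : BddAbove A := by
      refine ⟨p / (64 * C ^ 2 * M ^ 4 * (2 * d + 1) / c), fun S hS => ?_⟩
      rw [le_div_iff₀ (by positivity), mul_comm]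
      exact (hF1 S hS.1).trans hS.2
    have hsup : 0 < sSup A := by
      obtain ⟨S, hS⟩ := hnonempty
      exact (hc.trans_le hS.1).trans_le (le_csSup hbddA hS)
    -- one event for all admissible values: each of them is at most `2 * S`
    obtain ⟨S, hS, hSsup⟩ := exists_lt_of_lt_csSup hnonempty (half_lt_self hsup)
    have hS0 : 0 < S := hc.trans_le hS.1
    have hp : 0 < p := by
      have h1 : 0 < 64 * C ^ 2 * M ^ 4 * (2 * d + 1) / c * S := by positivity
      exact_mod_cast h1.trans_le ((hF1 S hS.1).trans hS.2)
    obtain ⟨E, hE, hPE, hclose⟩ := exists_event_kernel_close hd hφ_cont hM0 hL0 hM hlip hp hδ hδ1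
      (ε := c ^ 2 / (8 * C₀ * S ^ 2)) (by positivity)
      (union_bound_of_width hd hδ hδ1 (by positivity) hM0 hL0 hc hS0 hC1 (hX1 S hS.1) hS.2)
    refine ⟨E, hE, hPE, fun W hW _ hα z a hopt _ hp' j => ?_⟩
    have hmem : l1norm (interpCoeff φ W x y) + l1norm a ∈ A := ⟨hl1 hα j, hp'⟩
    have hle : l1norm (interpCoeff φ W x y) + l1norm a ≤ 2 * S := by
      have := le_csSup hbddA hmem
      linarith
    have hKn : K n ≤ C₀ := hKC n (hN n x hx hsep)
    refine exists_dist_lt_of_kernel_close hp hφ_cont hM hc (hK0 n) (hK n) hx hopt.1 hsep hα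
      (hclose W hW) (hopt.sum_smul_rfFeature_eq hx) ?_ j
    set T := l1norm (interpCoeff φ W x y) + l1norm a
    have hT0 : 0 ≤ T := hc.le.trans hmem.1
    calc K n * (T ^ 2 * (c ^ 2 / (8 * C₀ * S ^ 2)))
        ≤ C₀ * ((2 * S) ^ 2 * (c ^ 2 / (8 * C₀ * S ^ 2))) := by gcongr
      _ = c ^ 2 / 2 := by field_simp; norm_num
      _ < c ^ 2 := half_lt_self (by positivity)
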